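/- Let $p$ be a prime and $n$ a positive integer, and let $G=\mathbb{Z}_p\times\mathbb{Z}_{p^n}$, where $\mathbb{Z}_m=\mathbb{Z}/m\mathbb{Z}$. For $g=(g_1,g_2)$ and $h=(h_1,h_2)$ in $G$ put $$\langle g,h\rangle=p^{n-1}g_1h_1+g_2h_2\in\mathbb{Z}_{p^n},\qquad \chi_g(h)=e^{2\pi i\langle g,h\rangle/p^n}.$$ A subset $A\subseteq G$ is called spectral if there is a subset $B\subseteq G$ such that the functions $\chi_b$, $b\in B$, restricted to $A$, form an orthogonal basis of $L^2(A)$, the space of complex-valued functions on $A$ with the Hermitian inner product $\langle f,f'\rangle=\sum_{a\in A}f(a)\overline{f'(a)}$. A subset $A\subseteq G$ is called a tile of $G$ if there is a subset $T\subseteq G$ such that every element of $G$ can be written in exactly one way as $a+t$ with $a\in A$ and $t\in T$. Then a nonempty subset $A$ of $\mathbb{Z}_p\times\mathbb{Z}_{p^n}$ is spectral if and only if it is a tile of $\mathbb{Z}_p\times\mathbb{Z}_{p^n}$. -/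

import Mathlib

/-- The pairing `⟨u, v⟩ = p ^ (n - 1) * u₁ * v₁ + u₂ * v₂`, with values in `ℤ / p ^ n`, on the group
`ℤ / p × ℤ / p ^ n` (for `n ≥ 1`). The product `u₁ * v₁` is formed with integer representatives;
the result does not depend on their choice. -/
def pairing (p n : ℕ) (u v : ZMod p × ZMod (p ^ n)) : ZMod (p ^ n) :=
  ((p ^ (n - 1) * (u.1.val * v.1.val) : ℕ) : ZMod (p ^ n)) + u.2 * v.2

/-- The character `χ_g(h) = exp (2 π i ⟨g, h⟩ / p ^ n)` of `ℤ / p × ℤ / p ^ n`. Here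
`ZMod.stdAddChar` is the additive character `j ↦ exp (2 π i j / N)` of `ℤ / N`. -/
noncomputable def chi (p n : ℕ) [NeZero p] (g h : ZMod p × ZMod (p ^ n)) : ℂ :=
  ZMod.stdAddChar (pairing p n g h)

/-- The Hermitian inner product `⟨f, g⟩ = ∑ a ∈ A, f a * conj (g a)` on the space `L²(A)` of
complex valued functions on a finite set `A`. -/
noncomputable def l2Inner {G : Type*} {A : Finset G} (f g : A → ℂ) : ℂ :=
  ∑ a : A, f a * starRingEnd ℂ (g a)

/-- `(A, B)` is a spectral pair: the characters `χ_b`, `b ∈ B`, restricted to `A`, form an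
orthogonal basis of `L²(A)`. -/
def IsSpectralPair (p n : ℕ) [NeZero p] (A B : Finset (ZMod p × ZMod (p ^ n))) : Prop :=
  let e : B → (A → ℂ) := fun b a => chi p n b a
  (∀ b b' : B, b ≠ b' → l2Inner (e b) (e b') = 0) ∧
    LinearIndependent ℂ e ∧ Submodule.span ℂ (Set.range e) = ⊤

/-- `A` is a spectral set: it has a spectrum `B`. -/
def IsSpectral (p n : ℕ) [NeZero p] (A : Finset (ZMod p × ZMod (p ^ n))) : Prop :=
  ∃ B : Finset (ZMod p × ZMod (p ^ n)), IsSpectralPair p n A B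

/-- `A` is a tile of the group `G`: there is `T ⊆ G` such that every element of `G` has exactly one
representation `a + t` with `a ∈ A` and `t ∈ T`. -/
def IsTile {G : Type*} [AddCommGroup G] (A : Finset G) : Prop :=
  ∃ T : Finset G, ∀ g : G, ∃! x : G × G, x.1 ∈ A ∧ x.2 ∈ T ∧ x.1 + x.2 = g

/-! Write `n = m + 1`. Tiling by `A` and `T` forces `hat A * hat T` to vanish away from `0`; `B` is
a spectrum when `#B = #A` and `hat A` vanishes at all nonzero differences of `B`. So both properties
are governed by `#A` and the zeros of `hat A`. These zeros are stable under multiplication by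
integers prime to `p`, hence are known once one knows them at `(1, 0)` and at the elements `(c, p ^
(m - k))`, of slope `c` and level `k ≤ m`. A zero at slope `c` and level `k` is a counting
statement: for each residue class of the second coordinate modulo `p ^ k`, place the elements of `A`
on a `p × p` grid by first coordinate and next digit; then the parallel lines of direction
determined by `c` carry equally many elements.

Let `K` be the set of levels with a zero at slope `0`, and `r = #K`. Then `p ^ r` divides `#A`, and
in both directions `#A` turns out to be `p ^ r` or `p ^ (r + 1)`. For a tile, every level is a zero
level of `A` or of `T`, while `#A * #T = p ^ (m + 2)`. For a spectral set, the first coordinate and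
the `r` digits attached to `K` separate the points of the spectrum, and `card_eq_pow_of_levels`
shows that `#A` is a power of `p`.

If `#A = p ^ r`, sets of digit sums give both a complement and a spectrum. If `#A = p ^ (r + 1)`,
the hinge is `HasTwist`: it follows from either property (`hasTwist_of_spectrum`,
`hasTwist_of_tiling`) and yields both (`isTile_of_hasTwist`, `isSpectral_of_hasTwist`). -/

open Finset

/-! ### Vanishing sums of roots of unity of prime power order -/

section RootsOfUnity

variable {p m : ℕ} [Fact p.Prime]

/-- The cyclotomic polynomial is `∑ j < p, X ^ (j * p ^ m)` and the cofactor has degree below `p ^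
m`, so the product is `p` non-overlapping shifted copies of the cofactor. -/
lemma Polynomial.coeff_add_mul_eq_of_cyclotomic_dvd {P : Polynomial ℤ}
    (hdeg : P.natDegree < p ^ (m + 1)) (h : Polynomial.cyclotomic (p ^ (m + 1)) ℤ ∣ P)
    {t : ℕ} (ht : t < p ^ m) {i : ℕ} (hi : i < p) :
    P.coeff (t + i * p ^ m) = P.coeff t := by
  have hp : p.Prime := Fact.out
  obtain ⟨Q, rfl⟩ := h
  by_cases hQ : Q = 0
  · simp [hQ]
  have hQdeg : Q.natDegree < p ^ m := by
    rw [(Polynomial.cyclotomic.monic _ ℤ).natDegree_mul' hQ, Polynomial.natDegree_cyclotomic,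
      Nat.totient_prime_pow_succ hp, pow_succ] at hdeg
    have : p ^ m * (p - 1) + p ^ m = p ^ m * p := by
      rw [← Nat.mul_succ, Nat.succ_eq_add_one, Nat.sub_add_cancel hp.one_lt.le]
    omega
  have key : ∀ j < p, (Polynomial.cyclotomic (p ^ (m + 1)) ℤ * Q).coeff (t + j * p ^ m) =
      Q.coeff t := by
    intro j hj
    rw [Polynomial.cyclotomic_prime_pow_eq_geom_sum hp, Finset.sum_mul,
      Polynomial.finsetSum_coeff, Finset.sum_eq_single j]
    · rw [← pow_mul, Polynomial.coeff_X_pow_mul', if_pos (by rw [mul_comm]; omega)]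
      congr 1
      rw [mul_comm (p ^ m) j]; omega
    · intro l _ hlj
      rw [← pow_mul, Polynomial.coeff_X_pow_mul']
      split_ifs with hle
      · apply Polynomial.coeff_eq_zero_of_natDegree_lt
        have hl : l < j := by
          by_contra hcon
          have h1 : j + 1 ≤ l := by omega
          have h2 : p ^ m * (j + 1) ≤ p ^ m * l := Nat.mul_le_mul_left _ h1
          have h3 : p ^ m * (j + 1) = j * p ^ m + p ^ m := by ring
          omega
        have h2 : p ^ m * (l + 1) ≤ p ^ m * j := Nat.mul_le_mul_left _ hl
        have h3 : p ^ m * (l + 1) = p ^ m * l + p ^ m := by ring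
        have h4 : p ^ m * j = j * p ^ m := mul_comm _ _
        omega
      · rfl
    · intro hj'
      exact absurd (Finset.mem_range.2 hj) hj'
  rw [key i hi]
  simpa using (key 0 hp.pos).symm

lemma ZMod.stdAddChar_eq_pow_val {N : ℕ} [NeZero N] (z : ZMod N) :
    (ZMod.stdAddChar z : ℂ) = Complex.exp (2 * Real.pi * Complex.I / N) ^ z.val := by
  conv_lhs => rw [← ZMod.natCast_zmod_val z]
  rw [show ((z.val : ℕ) : ZMod N) = ((z.val : ℤ) : ZMod N) by push_cast; rfl, ZMod.stdAddChar_coe,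
    ← Complex.exp_nat_mul]
  congr 1
  push_cast
  ring

/-- A sum of `p ^ (m + 1)`-th roots of unity vanishes if and only if their exponents are equally
distributed on the cosets of the subgroup of order `p`. -/
theorem sum_stdAddChar_eq_zero_iff {ι : Type*} (A : Finset ι) (φ : ι → ZMod (p ^ (m + 1))) :
    ∑ a ∈ A, (ZMod.stdAddChar (φ a) : ℂ) = 0 ↔
      ∀ z, #{a ∈ A | φ a = z} = #{a ∈ A | φ a = z + (p : ZMod (p ^ (m + 1))) ^ m} := by
  have hp : p.Prime := Fact.out
  constructor
  · intro h
    set P : Polynomial ℤ := ∑ a ∈ A, Polynomial.X ^ (φ a).val with hP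
    have hcoeff : ∀ j, P.coeff j = #{a ∈ A | (φ a).val = j} := by
      intro j
      rw [hP, Polynomial.finsetSum_coeff, Finset.card_filter]
      push_cast
      refine Finset.sum_congr rfl fun a _ => ?_
      rw [Polynomial.coeff_X_pow]
      simp only [eq_comm]
    have hdeg : P.natDegree < p ^ (m + 1) := by
      have hpos : 0 < p ^ (m + 1) := pow_pos hp.pos _
      refine lt_of_le_of_lt (b := p ^ (m + 1) - 1) ?_ (by omega)
      refine Polynomial.natDegree_sum_le_of_forall_le _ _ fun a _ => ?_
      rw [Polynomial.natDegree_X_pow]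
      have := ZMod.val_lt (φ a)
      omega
    have hroot : Polynomial.aeval (Complex.exp (2 * Real.pi * Complex.I / (p ^ (m + 1) : ℕ))) P
        = 0 := by
      rw [hP, map_sum, ← h]
      refine Finset.sum_congr rfl fun a _ => ?_
      rw [map_pow, Polynomial.aeval_X, ZMod.stdAddChar_eq_pow_val]
    have hprim := Complex.isPrimitiveRoot_exp (p ^ (m + 1)) (NeZero.ne _)
    have hdvd : Polynomial.cyclotomic (p ^ (m + 1)) ℤ ∣ P := by
      rw [Polynomial.cyclotomic_eq_minpoly hprim (pow_pos hp.pos _)]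
      exact minpoly.isIntegrallyClosed_dvd (hprim.isIntegral (pow_pos hp.pos _)) hroot
    have hval : ∀ z : ZMod (p ^ (m + 1)),
        (#{a ∈ A | φ a = z} : ℤ) = P.coeff (z.val % p ^ m) := by
      intro z
      have h1 : #{a ∈ A | φ a = z} = #{a ∈ A | (φ a).val = z.val} := by
        congr 1
        refine Finset.filter_congr fun a _ => ?_
        exact ⟨fun h => by rw [h], fun h => ZMod.val_injective _ h⟩
      rw [h1, ← hcoeff, ← Polynomial.coeff_add_mul_eq_of_cyclotomic_dvd hdeg hdvd
        (Nat.mod_lt _ (pow_pos hp.pos m)) (i := z.val / p ^ m)]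
      · rw [mul_comm, Nat.mod_add_div]
      · rw [Nat.div_lt_iff_lt_mul (pow_pos hp.pos m), mul_comm, ← pow_succ]
        exact ZMod.val_lt z
    intro z
    have : (z + (p : ZMod (p ^ (m + 1))) ^ m).val % p ^ m = z.val % p ^ m := by
      rw [ZMod.val_add, Nat.mod_mod_of_dvd _ (pow_dvd_pow p (Nat.le_succ m)), ← Nat.cast_pow,
        ZMod.val_natCast, Nat.add_mod, Nat.mod_mod_of_dvd _ (pow_dvd_pow p (Nat.le_succ m))]
      simp
    zify
    rw [hval, hval, this]
  · intro h
    have hfib : ∀ w : ZMod (p ^ (m + 1)), ∑ a ∈ A, (ZMod.stdAddChar (φ a) : ℂ) =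
        ∑ z, (#{a ∈ A | φ a = z + w} : ℂ) * ZMod.stdAddChar (z + w) := by
      intro w
      rw [Fintype.sum_equiv (Equiv.addRight w)
        (fun z => (#{a ∈ A | φ a = z + w} : ℂ) * ZMod.stdAddChar (z + w))
        (fun z => (#{a ∈ A | φ a = z} : ℂ) * ZMod.stdAddChar z) (fun z => rfl),
        ← Finset.sum_fiberwise A φ]
      refine Finset.sum_congr rfl fun z _ => ?_
      rw [← nsmul_eq_mul, ← Finset.sum_const]
      refine Finset.sum_congr rfl fun a ha => ?_
      rw [(Finset.mem_filter.1 ha).2]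
    set w := (p : ZMod (p ^ (m + 1))) ^ m with hw
    have hw0 : w ≠ 0 := by
      rw [hw, ← Nat.cast_pow, Ne, ZMod.natCast_eq_zero_iff]
      exact fun hd => absurd (Nat.le_of_dvd (pow_pos hp.pos m) hd)
        (not_le.2 (Nat.pow_lt_pow_right hp.one_lt (Nat.lt_succ_self m)))
    -- Shifting all exponents by `w` preserves the multiplicities but multiplies the sum by a root
    -- of unity other than `1`.
    have h1 : ∑ a ∈ A, (ZMod.stdAddChar (φ a) : ℂ) =
        ZMod.stdAddChar w * ∑ a ∈ A, (ZMod.stdAddChar (φ a) : ℂ) := by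
      conv_lhs => rw [hfib w]
      conv_rhs => rw [hfib 0]
      rw [Finset.mul_sum]
      refine Finset.sum_congr rfl fun z _ => ?_
      rw [← h z, add_zero, AddChar.map_add_eq_mul]
      ring
    have h2 : (ZMod.stdAddChar w : ℂ) ≠ 1 := by
      intro hcon
      exact hw0 (ZMod.injective_stdAddChar (by rw [hcon, AddChar.map_zero_eq_one]))
    have h3 : ((ZMod.stdAddChar w : ℂ) - 1) * ∑ a ∈ A, (ZMod.stdAddChar (φ a) : ℂ) = 0 := by
      rw [sub_mul, one_mul, ← h1, sub_self]
    exact (mul_eq_zero.1 h3).resolve_left (sub_ne_zero.2 h2)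

end RootsOfUnity

/-! ### The pairing and the Fourier transform on `ℤ / p × ℤ / p ^ (m + 1)` -/

section Pairing

lemma addChar_map_sum {H ι : Type*} [AddCommGroup H] (ψ : AddChar H ℂ) (s : Finset ι) (f : ι → H) :
    ψ (∑ i ∈ s, f i) = ∏ i ∈ s, ψ (f i) := by
  classical
  induction s using Finset.induction_on with
  | empty => simp
  | insert i s hi ih => rw [Finset.sum_insert hi, Finset.prod_insert hi, AddChar.map_add_eq_mul, ih]

lemma pairing_comm {p m : ℕ} (g h : ZMod p × ZMod (p ^ (m + 1))) :
    pairing p (m + 1) g h = pairing p (m + 1) h g := by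
  unfold pairing
  rw [mul_comm g.1.val, mul_comm g.2]

variable {p m : ℕ} [Fact p.Prime]

lemma prime_pow_mul_intCast_eq_zero_iff (x : ℤ) :
    (p : ZMod (p ^ (m + 1))) ^ m * (x : ZMod (p ^ (m + 1))) = 0 ↔ (x : ZMod p) = 0 := by
  have hp : p.Prime := Fact.out
  rw [← Nat.cast_pow, ← Int.cast_natCast, ← Int.cast_mul, ZMod.intCast_zmod_eq_zero_iff_dvd,
    ZMod.intCast_zmod_eq_zero_iff_dvd]
  push_cast
  rw [pow_succ, mul_dvd_mul_iff_left (pow_ne_zero _ (by exact_mod_cast hp.ne_zero))]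

lemma pairing_intCast (x s y t : ℤ) :
    pairing p (m + 1) ((x : ZMod p), (s : ZMod (p ^ (m + 1)))) (y, t) =
      (p : ZMod (p ^ (m + 1))) ^ m * ((x * y : ℤ) : ZMod (p ^ (m + 1))) + s * t := by
  unfold pairing
  simp only [Nat.add_sub_cancel]
  congr 1
  rw [← sub_eq_zero]
  have h := (prime_pow_mul_intCast_eq_zero_iff (p := p) (m := m)
    ((((x : ZMod p).val : ℤ) * ((y : ZMod p).val : ℤ)) - x * y)).2 (by push_cast; simp)
  rw [← h]
  push_cast
  ring

lemma exists_intCast_prod (g : ZMod p × ZMod (p ^ (m + 1))) :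
    ∃ x s : ℤ, g = ((x : ZMod p), (s : ZMod (p ^ (m + 1)))) :=
  ⟨g.1.val, g.2.val, by ext <;> simp⟩

lemma pairing_add_right (g h h' : ZMod p × ZMod (p ^ (m + 1))) :
    pairing p (m + 1) g (h + h') = pairing p (m + 1) g h + pairing p (m + 1) g h' := by
  obtain ⟨x, s, rfl⟩ := exists_intCast_prod g
  obtain ⟨y, t, rfl⟩ := exists_intCast_prod h
  obtain ⟨z, u, rfl⟩ := exists_intCast_prod h'
  rw [Prod.mk_add_mk, ← Int.cast_add, ← Int.cast_add, pairing_intCast, pairing_intCast,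
    pairing_intCast]
  push_cast
  ring

/-- The pairing as an additive map in its second argument. -/
def pairingHom (g : ZMod p × ZMod (p ^ (m + 1))) :
    ZMod p × ZMod (p ^ (m + 1)) →+ ZMod (p ^ (m + 1)) :=
  AddMonoidHom.mk' (pairing p (m + 1) g) (pairing_add_right g)

lemma pairingHom_apply (g h : ZMod p × ZMod (p ^ (m + 1))) :
    pairingHom g h = pairing p (m + 1) g h := rfl

lemma pairingHom_comm (g h : ZMod p × ZMod (p ^ (m + 1))) :
    pairingHom g h = pairingHom h g := pairing_comm g h

lemma pairing_zsmul_left (w : ℤ) (g h : ZMod p × ZMod (p ^ (m + 1))) :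
    pairing p (m + 1) (w • g) h = w * pairing p (m + 1) g h := by
  rw [← pairingHom_apply, pairingHom_comm, map_zsmul, pairingHom_comm, pairingHom_apply,
    zsmul_eq_mul]

/-- The pairing is nondegenerate. -/
lemma exists_pairing_ne_zero {g : ZMod p × ZMod (p ^ (m + 1))} (hg : g ≠ 0) :
    ∃ h, pairing p (m + 1) g h ≠ 0 := by
  obtain ⟨x, s, rfl⟩ := exists_intCast_prod g
  by_cases hs : (s : ZMod (p ^ (m + 1))) = 0
  · refine ⟨(((1 : ℤ) : ZMod p), ((0 : ℤ) : ZMod (p ^ (m + 1)))), ?_⟩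
    rw [pairing_intCast, Int.cast_zero, mul_zero, add_zero, mul_one, Ne,
      prime_pow_mul_intCast_eq_zero_iff]
    intro hx
    exact hg (by ext <;> simp [hx, hs])
  · refine ⟨(((0 : ℤ) : ZMod p), ((1 : ℤ) : ZMod (p ^ (m + 1)))), ?_⟩
    rw [pairing_intCast]
    simpa using hs

/-- The character `χ_g` as an additive character. -/
noncomputable def chiChar (g : ZMod p × ZMod (p ^ (m + 1))) :
    AddChar (ZMod p × ZMod (p ^ (m + 1))) ℂ :=
  ZMod.stdAddChar.compAddMonoidHom (pairingHom g)

lemma chiChar_apply (g h : ZMod p × ZMod (p ^ (m + 1))) : chiChar g h = chi p (m + 1) g h := rfl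

lemma chiChar_comm (g h : ZMod p × ZMod (p ^ (m + 1))) : chiChar g h = chiChar h g := by
  rw [chiChar_apply, chiChar_apply, chi, chi, pairing_comm]

lemma chiChar_ne_one {g : ZMod p × ZMod (p ^ (m + 1))} (hg : g ≠ 0) : chiChar g ≠ 1 := by
  obtain ⟨h, hh⟩ := exists_pairing_ne_zero hg
  intro hcon
  refine hh (ZMod.injective_stdAddChar ?_)
  rw [AddChar.map_zero_eq_one]
  exact (DFunLike.congr_fun hcon h).trans rfl

lemma sum_chiChar (h : ZMod p × ZMod (p ^ (m + 1))) :
    ∑ g, chiChar g h = if h = 0 then (p : ℂ) ^ (m + 2) else 0 := by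
  simp_rw [chiChar_comm _ h]
  split_ifs with hh
  · subst hh
    simp_rw [chiChar_comm 0, AddChar.map_zero_eq_one]
    simp [ZMod.card]
    ring
  · exact AddChar.sum_eq_zero_of_ne_one (chiChar_ne_one hh)

/-- The Fourier transform of the indicator function of `A`. -/
noncomputable def hat (A : Finset (ZMod p × ZMod (p ^ (m + 1))))
    (g : ZMod p × ZMod (p ^ (m + 1))) : ℂ :=
  ∑ a ∈ A, chiChar g a

lemma hat_zero (A : Finset (ZMod p × ZMod (p ^ (m + 1)))) : hat A 0 = #A := by
  simp_rw [hat, chiChar_comm 0, AddChar.map_zero_eq_one]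
  simp

lemma hat_eq_zero_iff (A : Finset (ZMod p × ZMod (p ^ (m + 1))))
    (g : ZMod p × ZMod (p ^ (m + 1))) :
    hat A g = 0 ↔ ∀ z, #{a ∈ A | pairing p (m + 1) g a = z} =
      #{a ∈ A | pairing p (m + 1) g a = z + (p : ZMod (p ^ (m + 1))) ^ m} :=
  sum_stdAddChar_eq_zero_iff A (pairing p (m + 1) g)

lemma exists_intCast_mul_eq_one {w : ℤ} (hw : (w : ZMod p) ≠ 0) :
    ∃ v : ℤ, (v : ZMod (p ^ (m + 1))) * w = 1 ∧ (v : ZMod p) * w = 1 := by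
  have hp : p.Prime := Fact.out
  have hcop : IsCoprime (w : ℤ) ((p ^ (m + 1) : ℕ) : ℤ) := by
    push_cast
    refine IsCoprime.pow_right ?_
    rw [isCoprime_comm, (Nat.prime_iff_prime_int.1 hp).coprime_iff_not_dvd]
    rwa [Ne, ZMod.intCast_zmod_eq_zero_iff_dvd] at hw
  obtain ⟨v, r, hvr⟩ := hcop
  refine ⟨v, ?_, ?_⟩
  · have := congrArg (Int.cast : ℤ → ZMod (p ^ (m + 1))) hvr
    simpa only [Int.cast_add, Int.cast_mul, Int.cast_natCast, ZMod.natCast_self, mul_zero, add_zero,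
      Int.cast_one] using this
  · have := congrArg (Int.cast : ℤ → ZMod p) hvr
    simpa [pow_succ] using this

/-- In substance Galois conjugation; here, multiplication by a unit permutes the cosets of the
subgroup of order `p`, so equidistribution on them is preserved. -/
lemma hat_zsmul_eq_zero {A : Finset (ZMod p × ZMod (p ^ (m + 1)))}
    {g : ZMod p × ZMod (p ^ (m + 1))} (h : hat A g = 0) {w : ℤ} (hw : (w : ZMod p) ≠ 0) :
    hat A (w • g) = 0 := by
  rw [hat_eq_zero_iff] at h ⊢
  obtain ⟨v, hv, -⟩ := exists_intCast_mul_eq_one (m := m) hw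
  have hiter : ∀ (d : ℕ) z, #{a ∈ A | pairing p (m + 1) g a = z} =
      #{a ∈ A | pairing p (m + 1) g a = z + d * (p : ZMod (p ^ (m + 1))) ^ m} := by
    intro d
    induction d with
    | zero => simp
    | succ d ih =>
      intro z
      rw [ih z, h]
      congr! 3
      push_cast
      ring
  have hiff : ∀ z a, pairing p (m + 1) (w • g) a = z ↔ pairing p (m + 1) g a = v * z := by
    intro z a
    rw [pairing_zsmul_left]
    constructor
    · rintro rfl
      rw [← mul_assoc, hv, one_mul]
    · intro h
      rw [h, ← mul_assoc, mul_comm (w : ZMod (p ^ (m + 1))), hv, one_mul]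
  intro z
  simp_rw [hiff]
  rw [hiter (v : ZMod (p ^ (m + 1))).val]
  simp [mul_add]

end Pairing

/-! ### Criteria for tiles and for spectral sets -/

section Criteria

variable {p m : ℕ} [Fact p.Prime]

/-- The indicators of `A` and `T` convolve to the constant `1`, whose transform is supported at `0`.
-/
lemma IsTile.exists_hat_eq_zero {A : Finset (ZMod p × ZMod (p ^ (m + 1)))} (h : IsTile A) :
    ∃ T : Finset (ZMod p × ZMod (p ^ (m + 1))), #A * #T = p ^ (m + 2) ∧
      ∀ g, g ≠ 0 → hat A g = 0 ∨ hat T g = 0 := by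
  obtain ⟨T, hT⟩ := h
  have hbij : ∀ f : ZMod p × ZMod (p ^ (m + 1)) → ℂ,
      ∑ x ∈ A ×ˢ T, f (x.1 + x.2) = ∑ g, f g := by
    intro f
    refine Finset.sum_bij (fun x _ => x.1 + x.2) (fun _ _ => Finset.mem_univ _) ?_ ?_
      (fun _ _ => rfl)
    · intro x hx y hy hxy
      rw [Finset.mem_product] at hx hy
      exact (hT (x.1 + x.2)).unique ⟨hx.1, hx.2, rfl⟩ ⟨hy.1, hy.2, hxy.symm⟩
    · intro g _
      obtain ⟨x, hx, -⟩ := hT g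
      exact ⟨x, Finset.mem_product.2 ⟨hx.1, hx.2.1⟩, hx.2.2⟩
  refine ⟨T, ?_, fun g hg => ?_⟩
  · have := hbij fun _ => 1
    simp only [Finset.sum_const, Finset.card_product, Finset.card_univ, Fintype.card_prod,
      ZMod.card, nsmul_eq_mul, mul_one] at this
    have h2 : #A * #T = p * p ^ (m + 1) := by exact_mod_cast this
    rw [h2]; ring
  · have := hbij (chiChar g)
    rw [AddChar.sum_eq_zero_of_ne_one (chiChar_ne_one hg), Finset.sum_product] at this
    simp_rw [AddChar.map_add_eq_mul] at this
    rw [← Finset.sum_mul_sum] at this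
    exact mul_eq_zero.1 this

/-- A set tiles with the set of all digit sums `∑ d_l • τ_l`, `0 ≤ d_l < p`, as soon as it has the
right cardinality and each nontrivial character either annihilates `A` or maps some `τ_l` to a
primitive `p`-th root of unity. -/
lemma isTile_of_digit_sums {A : Finset (ZMod p × ZMod (p ^ (m + 1)))}
    {L : Type*} [Fintype L] [DecidableEq L] (τ : L → ZMod p × ZMod (p ^ (m + 1)))
    (hcard : #A * p ^ Fintype.card L = p ^ (m + 2))
    (h : ∀ g, g ≠ 0 → hat A g = 0 ∨ ∃ (l : L) (x : ℤ), (x : ZMod p) ≠ 0 ∧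
      pairing p (m + 1) g (τ l) = (p : ZMod (p ^ (m + 1))) ^ m * (x : ZMod (p ^ (m + 1)))) :
    IsTile A := by
  classical
  have hp : p.Prime := Fact.out
  let t : (L → Fin p) → ZMod p × ZMod (p ^ (m + 1)) := fun d => ∑ l, (d l : ℕ) • τ l
  have hzero : ∀ g, g ≠ 0 → (∑ a ∈ A, chiChar g a) * ∑ d, chiChar g (t d) = 0 := by
    intro g hg
    rcases h g hg with hA | ⟨l, x, hx, hl⟩
    · exact mul_eq_zero_of_left hA _
    · refine mul_eq_zero_of_right _ ?_
      have h1 : ∀ d, chiChar g (t d) = ∏ l, chiChar g (τ l) ^ (d l : ℕ) := by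
        intro d
        simp only [t, addChar_map_sum, AddChar.map_nsmul_eq_pow]
      simp_rw [h1]
      -- The character sum over digit vectors is a product of geometric sums, and the `l`-th one
      -- vanishes.
      have h2 := Finset.prod_univ_sum (fun _ : L => (Finset.univ : Finset (Fin p)))
        (fun l j => chiChar g (τ l) ^ (j : ℕ))
      rw [Fintype.piFinset_univ] at h2
      rw [← h2]
      refine Finset.prod_eq_zero (Finset.mem_univ l) ?_
      rw [Fin.sum_univ_eq_sum_range (fun j => chiChar g (τ l) ^ j) p]
      have hne : chiChar g (τ l) ≠ 1 := by
        intro hcon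
        have h3 : pairing p (m + 1) g (τ l) = 0 := by
          refine ZMod.injective_stdAddChar ?_
          rw [AddChar.map_zero_eq_one]
          exact hcon
        rw [hl, prime_pow_mul_intCast_eq_zero_iff] at h3
        exact hx h3
      have hpow : chiChar g (τ l) ^ p = 1 := by
        rw [← AddChar.map_nsmul_eq_pow]
        have h4 : pairing p (m + 1) g (p • τ l) = 0 := by
          rw [← pairingHom_apply, map_nsmul, pairingHom_apply, hl, nsmul_eq_mul, ← mul_assoc,
            ← pow_succ', ← Nat.cast_pow, ZMod.natCast_self, zero_mul]
        rw [chiChar_apply, chi, h4, AddChar.map_zero_eq_one]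
      rw [geom_sum_eq hne, hpow, sub_self, zero_div]
  have hone : ∀ g, #{x ∈ A ×ˢ (Finset.univ : Finset (L → Fin p)) | x.1 + t x.2 = g} = 1 := by
    intro g
    -- Fourier inversion: only the trivial character survives, so each `g` has the same number of
    -- representations, namely `1` by `hcard`.
    have h1 : ∑ x ∈ A ×ˢ (Finset.univ : Finset (L → Fin p)), ∑ χ, chiChar χ (x.1 + t x.2 - g) =
        (#{x ∈ A ×ˢ (Finset.univ : Finset (L → Fin p)) | x.1 + t x.2 = g} : ℂ) *
          (p : ℂ) ^ (m + 2) := by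
      simp_rw [sum_chiChar, sub_eq_zero]
      rw [← Finset.sum_filter, Finset.sum_const, nsmul_eq_mul]
    rw [Finset.sum_comm, Finset.sum_eq_single 0] at h1
    · simp_rw [chiChar_comm 0, AddChar.map_zero_eq_one] at h1
      have h2 : (p : ℂ) ^ (m + 2) ≠ 0 := pow_ne_zero _ (by exact_mod_cast hp.ne_zero)
      have h3 : ((#A * p ^ Fintype.card L : ℕ) : ℂ) = (p : ℂ) ^ (m + 2) := by
        rw [hcard]; push_cast; rfl
      simp only [Finset.sum_const, Finset.card_product, Finset.card_univ, Fintype.card_fun,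
        Fintype.card_fin, nsmul_eq_mul, mul_one] at h1
      rw [h3] at h1
      have h4 := mul_right_cancel₀ h2 ((one_mul _).trans h1)
      exact_mod_cast h4.symm
    · intro χ _ hχ
      rw [Finset.sum_product]
      have h2 : ∀ a d, chiChar χ (a + t d - g) =
          chiChar χ (-g) * (chiChar χ a * chiChar χ (t d)) := by
        intro a d
        rw [sub_eq_add_neg, AddChar.map_add_eq_mul, AddChar.map_add_eq_mul, mul_comm]
      simp_rw [h2]
      rw [← mul_zero (chiChar χ (-g)), ← hzero χ hχ, Finset.sum_mul_sum, Finset.mul_sum]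
      simp_rw [Finset.mul_sum]
    · simp
  refine ⟨Finset.univ.image t, fun g => ?_⟩
  obtain ⟨x, hx⟩ := Finset.card_eq_one.1 (hone g)
  have hxm := Finset.mem_singleton_self x
  rw [← hx, Finset.mem_filter, Finset.mem_product] at hxm
  refine ⟨(x.1, t x.2), ⟨hxm.1.1, Finset.mem_image_of_mem _ (Finset.mem_univ _), hxm.2⟩, ?_⟩
  rintro ⟨a, b⟩ ⟨ha, hb, hab⟩
  obtain ⟨d, -, rfl⟩ := Finset.mem_image.1 hb
  have h1 : (a, d) ∈ ({x} : Finset _) := by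
    rw [← hx, Finset.mem_filter, Finset.mem_product]
    exact ⟨⟨ha, Finset.mem_univ _⟩, hab⟩
  rw [← Finset.mem_singleton.1 h1]

lemma l2Inner_chi {A : Finset (ZMod p × ZMod (p ^ (m + 1)))}
    (b b' : ZMod p × ZMod (p ^ (m + 1))) :
    l2Inner (A := A) (fun a => chi p (m + 1) b a) (fun a => chi p (m + 1) b' a) =
      hat A (b - b') := by
  rw [l2Inner, hat, ← Finset.sum_coe_sort A]
  refine Finset.sum_congr rfl fun a _ => ?_
  rw [← chiChar_apply, ← chiChar_apply, chiChar_comm (b - b'), sub_eq_add_neg,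
    AddChar.map_add_eq_mul, AddChar.map_neg_eq_conj, chiChar_comm b, chiChar_comm b']

lemma IsSpectral.exists_hat_eq_zero {A : Finset (ZMod p × ZMod (p ^ (m + 1)))}
    (h : IsSpectral p (m + 1) A) :
    ∃ B : Finset (ZMod p × ZMod (p ^ (m + 1))), #B = #A ∧
      ∀ b ∈ B, ∀ b' ∈ B, b ≠ b' → hat A (b - b') = 0 := by
  obtain ⟨B, horth, hli, hspan⟩ := h
  refine ⟨B, ?_, fun b hb b' hb' hne => ?_⟩
  · have h1 := Module.finrank_eq_card_basis (Module.Basis.mk hli hspan.ge)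
    simpa using h1.symm
  · rw [← l2Inner_chi]
    exact horth ⟨b, hb⟩ ⟨b', hb'⟩ (by simpa using hne)

lemma isSpectral_of_hat_sub_eq_zero {A : Finset (ZMod p × ZMod (p ^ (m + 1)))} (hA : A.Nonempty)
    {J : Type*} [Fintype J] (hcard : Fintype.card J = #A)
    (β : J → ZMod p × ZMod (p ^ (m + 1))) (h : ∀ j j', j ≠ j' → hat A (β j - β j') = 0) :
    IsSpectral p (m + 1) A := by
  classical
  have hinj : Function.Injective β := by
    intro j j' hjj
    by_contra hne
    have h1 := h j j' hne
    rw [hjj, sub_self, hat_zero] at h1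
    exact hA.card_ne_zero (by exact_mod_cast h1)
  have hB : ∀ b ∈ Finset.univ.image β, ∀ b' ∈ Finset.univ.image β, b ≠ b' →
      hat A (b - b') = 0 := by
    intro b hb b' hb' hne
    obtain ⟨j, -, rfl⟩ := Finset.mem_image.1 hb
    obtain ⟨j', -, rfl⟩ := Finset.mem_image.1 hb'
    exact h j j' fun hj => hne (by rw [hj])
  have hBcard : #(Finset.univ.image β) = #A := by
    rw [Finset.card_image_of_injective _ hinj, Finset.card_univ, hcard]
  set B := Finset.univ.image β
  have horth : ∀ b b' : B, b ≠ b' → l2Inner (A := A) (fun a => chi p (m + 1) b a)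
      (fun a => chi p (m + 1) b' a) = 0 := by
    intro b b' hne
    rw [l2Inner_chi]
    exact hB b b.2 b' b'.2 fun hj => hne (Subtype.ext hj)
  have hli : LinearIndependent ℂ (fun (b : B) (a : A) => chi p (m + 1) b a) := by
    rw [Fintype.linearIndependent_iff]
    intro c hc b
    have h1 : l2Inner (∑ b' : B, c b' • fun a : A => chi p (m + 1) b' a)
        (fun a : A => chi p (m + 1) b a) = c b * #A := by
      have h2 : l2Inner (∑ b' : B, c b' • fun a : A => chi p (m + 1) b' a)
          (fun a : A => chi p (m + 1) b a) =
          ∑ b' : B, c b' * l2Inner (fun a : A => chi p (m + 1) b' a)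
            (fun a : A => chi p (m + 1) b a) := by
        simp only [l2Inner, Finset.sum_apply, Pi.smul_apply, smul_eq_mul, Finset.sum_mul,
          Finset.mul_sum, mul_assoc]
        exact Finset.sum_comm
      rw [h2, Finset.sum_eq_single b]
      · rw [l2Inner_chi, sub_self, hat_zero]
      · intro b' _ hne
        rw [horth b' b hne, mul_zero]
      · simp
    rw [hc] at h1
    have h3 : c b * (#A : ℂ) = 0 := by
      rw [← h1]
      simp [l2Inner]
    exact (mul_eq_zero.1 h3).resolve_right (by exact_mod_cast hA.card_ne_zero)
  refine ⟨B, horth, hli, ?_⟩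
  refine hli.span_eq_top_of_card_eq_finrank' ?_
  simp [hBcard]

end Criteria

/-! ### Zeros of the Fourier transform and equidistribution -/

section Levels

variable {p m : ℕ} [Fact p.Prime]

lemma hat_zsmul_eq_zero_iff {A : Finset (ZMod p × ZMod (p ^ (m + 1)))}
    {g : ZMod p × ZMod (p ^ (m + 1))} {w : ℤ} (hw : (w : ZMod p) ≠ 0) :
    hat A (w • g) = 0 ↔ hat A g = 0 := by
  refine ⟨fun h => ?_, fun h => hat_zsmul_eq_zero h hw⟩
  obtain ⟨v, h1, h2⟩ := exists_intCast_mul_eq_one (m := m) hw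
  have hv : (v : ZMod p) ≠ 0 := by
    rintro hv
    rw [hv, zero_mul] at h2
    exact zero_ne_one h2
  have h3 := hat_zsmul_eq_zero h hv
  have h4 : v • w • g = g := by
    rw [← mul_smul]
    ext
    · rw [Prod.smul_fst, zsmul_eq_mul, Int.cast_mul, h2, one_mul]
    · rw [Prod.smul_snd, zsmul_eq_mul, Int.cast_mul, h1, one_mul]
  rwa [h4] at h3

/-- The element `(c, p ^ (m - k))`, of order `p ^ (k + 1)`. Up to multiplication by units,
these are all the elements with nonzero second coordinate. -/
def levelElt (c : ZMod p) (k : ℕ) : ZMod p × ZMod (p ^ (m + 1)) :=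
  (c, (p : ZMod (p ^ (m + 1))) ^ (m - k))

lemma hat_eq_zero_iff_levelElt {A : Finset (ZMod p × ZMod (p ^ (m + 1)))}
    {g : ZMod p × ZMod (p ^ (m + 1))} {w : ℤ} {k : ℕ} (hw : (w : ZMod p) ≠ 0)
    (hg : g.2 = w * (p : ZMod (p ^ (m + 1))) ^ (m - k)) :
    hat A g = 0 ↔ hat A (levelElt (g.1 / w) k) = 0 := by
  rw [← hat_zsmul_eq_zero_iff (g := levelElt _ _) hw]
  congr! 2
  ext
  · rw [Prod.smul_fst, zsmul_eq_mul, levelElt, mul_div_cancel₀ _ hw]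
  · rw [Prod.smul_snd, zsmul_eq_mul, levelElt, hg]

lemma hat_eq_zero_iff_of_snd_eq_zero {A : Finset (ZMod p × ZMod (p ^ (m + 1)))}
    {g : ZMod p × ZMod (p ^ (m + 1))} (h1 : g.1 ≠ 0) (h2 : g.2 = 0) :
    hat A g = 0 ↔ hat A (1, 0) = 0 := by
  have hw : (((g.1.val : ℤ)) : ZMod p) ≠ 0 := by simpa using h1
  rw [← hat_zsmul_eq_zero_iff (g := (1, 0)) hw]
  congr! 2
  ext
  · simp
  · simp [h2]

lemma exists_level {x : ZMod (p ^ (m + 1))} (hx : x ≠ 0) :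
    ∃ k ≤ m, ∃ w : ℤ, (w : ZMod p) ≠ 0 ∧ x = w * (p : ZMod (p ^ (m + 1))) ^ (m - k) := by
  have hp : p.Prime := Fact.out
  have hx0 : x.val ≠ 0 := by rwa [Ne, ZMod.val_eq_zero]
  obtain ⟨i, w, hw, hxw⟩ := Nat.exists_eq_pow_mul_and_not_dvd hx0 p hp.ne_one
  have hi : i ≤ m := by
    by_contra hcon
    have h1 : p ^ (m + 1) ≤ x.val := by
      rw [hxw]
      calc p ^ (m + 1) ≤ p ^ i := Nat.pow_le_pow_right hp.pos (by omega)
        _ ≤ p ^ i * w := Nat.le_mul_of_pos_right _ (Nat.pos_of_ne_zero (by rintro rfl; simp at hw))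
    exact absurd (ZMod.val_lt x) (by omega)
  refine ⟨m - i, Nat.sub_le _ _, w, ?_, ?_⟩
  · rw [Int.cast_natCast, Ne, ZMod.natCast_eq_zero_iff]
    exact hw
  · rw [Nat.sub_sub_self hi, ← ZMod.natCast_zmod_val x, hxw]
    push_cast
    ring

/-- The number of elements of `A` with first coordinate `x` and second coordinate congruent to `y`
modulo `p ^ k`. -/
def cell (A : Finset (ZMod p × ZMod (p ^ (m + 1)))) (k : ℕ) (x : ZMod p) (y : ℤ) : ℕ :=
  #{a ∈ A | a.1 = x ∧ (p : ℤ) ^ k ∣ (a.2.val : ℤ) - y}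

/-- The part of `cell A k x y` in which the next digit of the second coordinate, relative to `y`,
is `d`. -/
def subcell (A : Finset (ZMod p × ZMod (p ^ (m + 1)))) (k : ℕ) (y : ℤ) (x d : ZMod p) : ℕ :=
  #{a ∈ A | a.1 = x ∧ (p : ℤ) ^ k ∣ (a.2.val : ℤ) - y ∧
    ((((a.2.val : ℤ) - y) / (p : ℤ) ^ k : ℤ) : ZMod p) = d}

lemma cell_eq_sum_subcell (A : Finset (ZMod p × ZMod (p ^ (m + 1)))) (k : ℕ) (x : ZMod p) (y : ℤ) :
    cell A k x y = ∑ d, subcell A k y x d := by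
  rw [cell, Finset.card_eq_sum_card_fiberwise (t := Finset.univ)
    (f := fun a => ((((a.2.val : ℤ) - y) / (p : ℤ) ^ k : ℤ) : ZMod p)) (by simp)]
  refine Finset.sum_congr rfl fun d _ => ?_
  rw [subcell, Finset.filter_filter]
  simp only [and_assoc]

lemma pow_succ_dvd_sub_iff (k : ℕ) (v s : ℤ) :
    (p : ℤ) ^ (k + 1) ∣ v - (p : ℤ) ^ k * s ↔
      (p : ℤ) ^ k ∣ v ∧ ((v / (p : ℤ) ^ k : ℤ) : ZMod p) = s := by
  have hp : p.Prime := Fact.out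
  have hpk : (p : ℤ) ^ k ≠ 0 := pow_ne_zero _ (by exact_mod_cast hp.ne_zero)
  constructor
  · intro h
    have h1 : (p : ℤ) ^ k ∣ v := by
      have := (pow_dvd_pow (p : ℤ) (Nat.le_succ k)).trans h
      exact (dvd_sub_left (Dvd.intro _ rfl)).1 this
    refine ⟨h1, ?_⟩
    obtain ⟨t, rfl⟩ := h1
    rw [Int.mul_ediv_cancel_left _ hpk, ← sub_eq_zero, ← Int.cast_sub,
      ZMod.intCast_zmod_eq_zero_iff_dvd]
    rwa [← mul_sub, pow_succ, mul_dvd_mul_iff_left hpk] at h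
  · rintro ⟨⟨t, rfl⟩, h2⟩
    rw [Int.mul_ediv_cancel_left _ hpk, ← sub_eq_zero, ← Int.cast_sub,
      ZMod.intCast_zmod_eq_zero_iff_dvd] at h2
    rwa [← mul_sub, pow_succ, mul_dvd_mul_iff_left hpk]

lemma subcell_intCast (A : Finset (ZMod p × ZMod (p ^ (m + 1)))) (k : ℕ) (y : ℤ) (x : ZMod p)
    (d : ℤ) : subcell A k y x d = cell A (k + 1) x (y + (p : ℤ) ^ k * d) := by
  rw [subcell, cell]
  congr 1
  refine Finset.filter_congr fun a _ => ?_
  rw [← sub_sub, pow_succ_dvd_sub_iff]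

lemma subcell_zero (A : Finset (ZMod p × ZMod (p ^ (m + 1)))) (k : ℕ) (y : ℤ) (x : ZMod p) :
    subcell A k y x 0 = cell A (k + 1) x y := by
  simpa using subcell_intCast A k y x 0

lemma dvd_subcell {A : Finset (ZMod p × ZMod (p ^ (m + 1)))} {k q : ℕ}
    (h : ∀ x y, q ∣ cell A (k + 1) x y) (y : ℤ) (x d : ZMod p) : q ∣ subcell A k y x d := by
  have := subcell_intCast A k y x d.val
  rw [Int.cast_natCast, ZMod.natCast_zmod_val] at this
  rw [this]
  exact h _ _

lemma sum_cell_zero (A : Finset (ZMod p × ZMod (p ^ (m + 1)))) (y : ℤ) :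
    ∑ x, cell A 0 x y = #A := by
  rw [Finset.card_eq_sum_card_fiberwise (t := Finset.univ) (f := fun a => a.1) (by simp)]
  simp [cell]

/-- The pairing is `p ^ (m - k) * (a.2 + p ^ k * c * a.1)`, so it sees exactly `a.2 + p ^ k * c *
a.1` modulo `p ^ (k + 1)`: the residue modulo `p ^ k` and a line in the grid of first coordinate and
next digit. -/
lemma pairing_levelElt_eq_iff {k : ℕ} (hk : k ≤ m) (c : ZMod p)
    (a : ZMod p × ZMod (p ^ (m + 1))) (y s : ℤ) :
    pairing p (m + 1) (levelElt c k) a =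
        (p : ZMod (p ^ (m + 1))) ^ (m - k) * ((y + (p : ℤ) ^ k * s : ℤ) : ZMod (p ^ (m + 1))) ↔
      (p : ℤ) ^ k ∣ (a.2.val : ℤ) - y ∧
        ((((a.2.val : ℤ) - y) / (p : ℤ) ^ k : ℤ) : ZMod p) = s - c * a.1 := by
  have hp : p.Prime := Fact.out
  have h1 : pairing p (m + 1) (levelElt c k) a =
      pairing p (m + 1) (((c.val : ℤ) : ZMod p), (((p : ℤ) ^ (m - k) : ℤ) : ZMod (p ^ (m + 1))))
        (((a.1.val : ℤ) : ZMod p), ((a.2.val : ℤ) : ZMod (p ^ (m + 1)))) := by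
    congr 1 <;> ext <;> simp [levelElt]
  have hm : (p : ℤ) ^ m = (p : ℤ) ^ (m - k) * (p : ℤ) ^ k := by
    rw [← pow_add, Nat.sub_add_cancel hk]
  have hm' : (p : ℤ) ^ (m + 1) = (p : ℤ) ^ (m - k) * (p : ℤ) ^ (k + 1) := by
    rw [← pow_add]; congr 1; omega
  have h2 : (p : ZMod (p ^ (m + 1))) ^ m * ((c.val * a.1.val : ℤ) : ZMod (p ^ (m + 1))) +
      (((p : ℤ) ^ (m - k) : ℤ) : ZMod (p ^ (m + 1))) * ((a.2.val : ℤ) : ZMod (p ^ (m + 1))) -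
      (p : ZMod (p ^ (m + 1))) ^ (m - k) * ((y + (p : ℤ) ^ k * s : ℤ) : ZMod (p ^ (m + 1))) =
      (((p : ℤ) ^ (m - k) * ((a.2.val : ℤ) - y - (p : ℤ) ^ k * (s - c.val * a.1.val)) : ℤ) :
        ZMod (p ^ (m + 1))) := by
    have h3 : (p : ZMod (p ^ (m + 1))) ^ m = (p : ZMod (p ^ (m + 1))) ^ (m - k) *
      (p : ZMod (p ^ (m + 1))) ^ k := by rw [← pow_add, Nat.sub_add_cancel hk]
    rw [h3]
    push_cast
    ring
  rw [h1, pairing_intCast, ← sub_eq_zero, h2, ZMod.intCast_zmod_eq_zero_iff_dvd, Nat.cast_pow, hm',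
    mul_dvd_mul_iff_left (pow_ne_zero _ (by exact_mod_cast hp.ne_zero)), pow_succ_dvd_sub_iff]
  simp

lemma card_pairing_levelElt (A : Finset (ZMod p × ZMod (p ^ (m + 1)))) {k : ℕ} (hk : k ≤ m)
    (c : ZMod p) (y s : ℤ) :
    #{a ∈ A | pairing p (m + 1) (levelElt c k) a =
        (p : ZMod (p ^ (m + 1))) ^ (m - k) * ((y + (p : ℤ) ^ k * s : ℤ) : ZMod (p ^ (m + 1)))} =
      ∑ x, subcell A k y x (s - c * x) := by
  simp_rw [pairing_levelElt_eq_iff hk]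
  rw [Finset.card_eq_sum_card_fiberwise (t := Finset.univ) (f := fun a => a.1) (by simp)]
  refine Finset.sum_congr rfl fun x _ => ?_
  rw [subcell, Finset.filter_filter]
  congr 1
  refine Finset.filter_congr fun a _ => ?_
  constructor
  · rintro ⟨⟨h1, h2⟩, rfl⟩
    exact ⟨rfl, h1, h2⟩
  · rintro ⟨rfl, h1, h2⟩
    exact ⟨⟨h1, h2⟩, rfl⟩

/-- The vanishing makes the `p` parallel lines `d + c * x = s` in the grid carry equal weight, and
together they partition it. -/
lemma mul_sum_subcell {A : Finset (ZMod p × ZMod (p ^ (m + 1)))} {k : ℕ} (hk : k ≤ m) {c : ZMod p}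
    (h : hat A (levelElt c k) = 0) (y : ℤ) (s : ZMod p) :
    p * ∑ x, subcell A k y x (s - c * x) = ∑ x, cell A k x y := by
  have hstep : ∀ s : ℕ, ∑ x, subcell A k y x ((s : ZMod p) - c * x) =
      ∑ x, subcell A k y x (0 - c * x) := by
    intro s
    induction s with
    | zero => simp
    | succ s ih =>
      rw [← ih]
      have h1 := card_pairing_levelElt A hk c y s
      have h2 := card_pairing_levelElt A hk c y (s + 1)
      have h3 := (hat_eq_zero_iff A _).1 h ((p : ZMod (p ^ (m + 1))) ^ (m - k) *
        ((y + (p : ℤ) ^ k * s : ℤ) : ZMod (p ^ (m + 1))))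
      have h4 : (p : ZMod (p ^ (m + 1))) ^ (m - k) *
          ((y + (p : ℤ) ^ k * s : ℤ) : ZMod (p ^ (m + 1))) + (p : ZMod (p ^ (m + 1))) ^ m =
          (p : ZMod (p ^ (m + 1))) ^ (m - k) *
            ((y + (p : ℤ) ^ k * (s + 1) : ℤ) : ZMod (p ^ (m + 1))) := by
        have h5 : (p : ZMod (p ^ (m + 1))) ^ m = (p : ZMod (p ^ (m + 1))) ^ (m - k) *
          (p : ZMod (p ^ (m + 1))) ^ k := by rw [← pow_add, Nat.sub_add_cancel hk]
        rw [h5]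
        push_cast
        ring
      rw [h4, h1, h2] at h3
      push_cast at h3 ⊢
      exact h3.symm
  have hconst : ∀ s' : ZMod p, ∑ x, subcell A k y x (s' - c * x) =
      ∑ x, subcell A k y x (s - c * x) := by
    intro s'
    have h1 := hstep s'.val
    have h2 := hstep s.val
    rw [ZMod.natCast_zmod_val] at h1 h2
    rw [h1, h2]
  have hsum : ∑ s' : ZMod p, ∑ x, subcell A k y x (s' - c * x) =
      p * ∑ x, subcell A k y x (s - c * x) := by
    simp_rw [hconst]
    simp [ZMod.card]
  rw [← hsum, Finset.sum_comm]
  refine Finset.sum_congr rfl fun x _ => ?_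
  rw [cell_eq_sum_subcell]
  exact Fintype.sum_equiv (Equiv.subRight (c * x)) _ _ fun _ => rfl

lemma mul_sum_cell_succ {A : Finset (ZMod p × ZMod (p ^ (m + 1)))} {k : ℕ} (hk : k ≤ m)
    (h : hat A (levelElt 0 k) = 0) (y : ℤ) :
    p * ∑ x, cell A (k + 1) x y = ∑ x, cell A k x y := by
  rw [← mul_sum_subcell hk h y 0]
  simp [subcell_zero]

/-- If the Fourier transform vanishes at all elements of a level, then each cell is equidistributed
among its subcells. -/
lemma mul_cell_succ {A : Finset (ZMod p × ZMod (p ^ (m + 1)))} {k : ℕ} (hk : k ≤ m)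
    (h : ∀ c, hat A (levelElt c k) = 0) (x : ZMod p) (y : ℤ) :
    p * cell A (k + 1) x y = cell A k x y := by
  have hp : p.Prime := Fact.out
  -- The choice `s = c * x` selects the lines through the grid point `(x, 0)`. As `c` varies they
  -- cover this point `p` times and every point off its column once.
  have h1 : ∑ c : ZMod p, p * ∑ x', subcell A k y x' (c * x - c * x') =
      p * ∑ x', cell A k x' y := by
    rw [Finset.sum_congr rfl fun c _ => mul_sum_subcell hk (h c) y (c * x)]
    simp [ZMod.card]
  rw [← Finset.mul_sum] at h1
  have h2 := Nat.eq_of_mul_eq_mul_left hp.pos h1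
  rw [Finset.sum_comm, ← Finset.add_sum_erase _ _ (Finset.mem_univ x),
    ← Finset.add_sum_erase _ (fun x' => cell A k x' y) (Finset.mem_univ x)] at h2
  have h3 : ∑ x' ∈ Finset.univ.erase x, ∑ c, subcell A k y x' (c * x - c * x') =
      ∑ x' ∈ Finset.univ.erase x, cell A k x' y := by
    refine Finset.sum_congr rfl fun x' hx' => ?_
    rw [cell_eq_sum_subcell]
    have hne : x - x' ≠ 0 := sub_ne_zero.2 (Finset.ne_of_mem_erase hx').symm
    refine Fintype.sum_equiv (Equiv.mulRight₀ (x - x') hne) _ _ fun c => ?_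
    simp only [Equiv.mulRight₀_apply, mul_sub]
  rw [h3] at h2
  have h4 := Nat.add_right_cancel h2
  rw [← h4]
  simp [ZMod.card, subcell_zero]

lemma mul_cell_zero {A : Finset (ZMod p × ZMod (p ^ (m + 1)))} (h : hat A (1, 0) = 0)
    (x : ZMod p) (y : ℤ) : p * cell A 0 x y = #A := by
  have hp : p.Prime := Fact.out
  have hpair : ∀ (a : ZMod p × ZMod (p ^ (m + 1))) (s : ℤ), pairing p (m + 1) (1, 0) a =
      (p : ZMod (p ^ (m + 1))) ^ m * (s : ZMod (p ^ (m + 1))) ↔ a.1 = s := by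
    intro a s
    have h1 : pairing p (m + 1) (1, 0) a =
        pairing p (m + 1) (((1 : ℤ) : ZMod p), ((0 : ℤ) : ZMod (p ^ (m + 1))))
        (((a.1.val : ℤ) : ZMod p), ((a.2.val : ℤ) : ZMod (p ^ (m + 1)))) := by
      congr 1 <;> ext <;> simp
    rw [h1, pairing_intCast, Int.cast_zero, zero_mul, add_zero, ← sub_eq_zero, ← mul_sub,
      ← Int.cast_sub, prime_pow_mul_intCast_eq_zero_iff]
    simp [sub_eq_zero]
  have hcell : ∀ s : ℤ, cell A 0 s y = #{a ∈ A | pairing p (m + 1) (1, 0) a =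
      (p : ZMod (p ^ (m + 1))) ^ m * (s : ZMod (p ^ (m + 1)))} := by
    intro s
    simp_rw [hpair]
    simp [cell]
  have hstep : ∀ s : ℕ, cell A 0 (s : ZMod p) y = cell A 0 0 y := by
    intro s
    induction s with
    | zero => simp
    | succ s ih =>
      rw [← ih]
      have h1 := hcell s
      have h2 := hcell (s + 1)
      rw [(hat_eq_zero_iff A _).1 h] at h1
      push_cast at h1 h2 ⊢
      rw [h1, h2]
      congr! 3
      ring
  have hconst : ∀ x' : ZMod p, cell A 0 x' y = cell A 0 x y := by
    intro x'
    have h1 := hstep x'.val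
    have h2 := hstep x.val
    rw [ZMod.natCast_zmod_val] at h1 h2
    rw [h1, h2]
  rw [← sum_cell_zero A y]
  simp_rw [hconst]
  simp [ZMod.card]

/-- The levels `k < j` at which the Fourier transform of `A` vanishes at `(0, p ^ (m - k))`. -/
noncomputable def zeroLevels (A : Finset (ZMod p × ZMod (p ^ (m + 1)))) (j : ℕ) : Finset ℕ :=
  {k ∈ Finset.range j | hat A (levelElt 0 k) = 0}

lemma mem_zeroLevels {A : Finset (ZMod p × ZMod (p ^ (m + 1)))} {j k : ℕ} :
    k ∈ zeroLevels A j ↔ k < j ∧ hat A (levelElt 0 k) = 0 := by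
  rw [zeroLevels, Finset.mem_filter, Finset.mem_range]

lemma card_zeroLevels_succ_of_mem {A : Finset (ZMod p × ZMod (p ^ (m + 1)))} {j : ℕ}
    (h : hat A (levelElt 0 j) = 0) : #(zeroLevels A (j + 1)) = #(zeroLevels A j) + 1 := by
  rw [zeroLevels, Finset.range_add_one, Finset.filter_insert, if_pos h,
    Finset.card_insert_of_notMem (by simp), zeroLevels]

lemma zeroLevels_succ_of_ne {A : Finset (ZMod p × ZMod (p ^ (m + 1)))} {j : ℕ}
    (h : hat A (levelElt 0 j) ≠ 0) : zeroLevels A (j + 1) = zeroLevels A j := by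
  rw [zeroLevels, Finset.range_add_one, Finset.filter_insert, if_neg h, zeroLevels]

lemma dvd_cell_of_dvd_cell_succ {A : Finset (ZMod p × ZMod (p ^ (m + 1)))} {k q : ℕ}
    (h : ∀ x y, q ∣ cell A (k + 1) x y) (x : ZMod p) (y : ℤ) : q ∣ cell A k x y := by
  rw [cell_eq_sum_subcell]
  exact Finset.dvd_sum fun d _ => dvd_subcell h _ _ _

/-- Descend from modulus `p ^ j` to `1`: a class is a disjoint union of `p` subclasses, and at a
zero level these have equal size, which gains a factor `p`. -/
lemma mul_pow_card_zeroLevels_dvd {A : Finset (ZMod p × ZMod (p ^ (m + 1)))} {j : ℕ}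
    (hj : j ≤ m + 1) {q : ℕ} (h : ∀ y, q ∣ ∑ x, cell A j x y) :
    q * p ^ #(zeroLevels A j) ∣ #A := by
  induction j generalizing q with
  | zero =>
    rw [← sum_cell_zero A 0]
    simpa [zeroLevels] using h 0
  | succ j ih =>
    by_cases hz : hat A (levelElt 0 j) = 0
    · rw [card_zeroLevels_succ_of_mem hz, pow_succ', ← mul_assoc, mul_comm q p]
      refine ih (by omega) fun y => ?_
      rw [← mul_sum_cell_succ (by omega) hz]
      exact Nat.mul_dvd_mul_left p (h y)
    · rw [zeroLevels_succ_of_ne hz]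
      refine ih (by omega) fun y => ?_
      simp_rw [cell_eq_sum_subcell]
      rw [Finset.sum_comm]
      refine Finset.dvd_sum fun d _ => ?_
      have h2 : ∀ x, subcell A j y x d = cell A (j + 1) x (y + (p : ℤ) ^ j * (d.val : ℤ)) := by
        intro x
        have := subcell_intCast A j y x d.val
        rwa [Int.cast_natCast, ZMod.natCast_zmod_val] at this
      simp_rw [h2]
      exact h _

lemma pow_card_zeroLevels_dvd (A : Finset (ZMod p × ZMod (p ^ (m + 1)))) :
    p ^ #(zeroLevels A (m + 1)) ∣ #A := by
  simpa using mul_pow_card_zeroLevels_dvd (A := A) le_rfl (q := 1) (by simp)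

end Levels

/-! ### Digits, and the cardinality of a spectral set -/

section Digits

variable {p m : ℕ} [Fact p.Prime]

/-- The digit of weight `p ^ i` of the second coordinate. -/
def digit (i : ℕ) (b : ZMod p × ZMod (p ^ (m + 1))) : ZMod p :=
  (((b.2.val : ℤ) / (p : ℤ) ^ i : ℤ) : ZMod p)

/-- No borrow occurs: the integer representatives differ by a multiple of `p ^ i`, and the ambiguity
modulo `p ^ (m + 1)` affects only digits above `i`. -/
lemma digit_sub_digit {b b' : ZMod p × ZMod (p ^ (m + 1))} {w : ℤ} {i j : ℕ} (hi : i ≤ m)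
    (hj : j ≤ i) (h : (b - b').2 = w * (p : ZMod (p ^ (m + 1))) ^ i) :
    digit j b - digit j b' = w * (p : ZMod p) ^ (i - j) := by
  have hp : p.Prime := Fact.out
  have h1 : (((b.2.val : ℤ) - b'.2.val - w * (p : ℤ) ^ i : ℤ) : ZMod (p ^ (m + 1))) = 0 := by
    push_cast
    rw [ZMod.natCast_zmod_val, ZMod.natCast_zmod_val, ← h, Prod.snd_sub, sub_self]
  rw [ZMod.intCast_zmod_eq_zero_iff_dvd] at h1
  obtain ⟨t, ht⟩ := h1
  have h2 : (b.2.val : ℤ) =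
      b'.2.val + ((w + (p : ℤ) ^ (m - i) * p * t) * (p : ℤ) ^ (i - j)) * (p : ℤ) ^ j := by
    have h3 : (p : ℤ) ^ (m + 1) = (p : ℤ) ^ (m - i) * p * ((p : ℤ) ^ (i - j) * (p : ℤ) ^ j) := by
      rw [← pow_add, ← pow_succ, ← pow_add]; congr 1; omega
    have h4 : (p : ℤ) ^ i = (p : ℤ) ^ (i - j) * (p : ℤ) ^ j := by
      rw [← pow_add]; congr 1; omega
    rw [Nat.cast_pow, h3, h4] at ht
    linear_combination ht
  rw [digit, digit, h2,
    Int.add_mul_ediv_right _ _ (pow_ne_zero _ (by exact_mod_cast hp.ne_zero))]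
  push_cast
  simp

lemma digit_sub_digit_self {b b' : ZMod p × ZMod (p ^ (m + 1))} {w : ℤ} {i : ℕ} (hi : i ≤ m)
    (h : (b - b').2 = w * (p : ZMod (p ^ (m + 1))) ^ i) :
    digit i b - digit i b' = w := by
  simpa using digit_sub_digit hi le_rfl h

lemma digit_eq_digit {b b' : ZMod p × ZMod (p ^ (m + 1))} {w : ℤ} {i j : ℕ} (hi : i ≤ m)
    (hj : j < i) (h : (b - b').2 = w * (p : ZMod (p ^ (m + 1))) ^ i) :
    digit j b = digit j b' := by
  have h1 := digit_sub_digit hi hj.le h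
  rw [CharP.cast_eq_zero, zero_pow (by omega), mul_zero] at h1
  exact sub_eq_zero.1 h1

lemma digit_eq_digit_of_snd {b b' : ZMod p × ZMod (p ^ (m + 1))} (j : ℕ) (h : (b - b').2 = 0) :
    digit j b = digit j b' := by
  rw [Prod.snd_sub, sub_eq_zero] at h
  rw [digit, digit, h]

/-- A function `ξ` on a set `B`, together with the digits at the levels in `K`. -/
def digitMap (ξ : ZMod p × ZMod (p ^ (m + 1)) → ZMod p) (K : Finset ℕ)
    (b : ZMod p × ZMod (p ^ (m + 1))) : ZMod p × (K → ZMod p) :=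
  (ξ b, fun k => digit (m - k) b)

lemma injOn_digitMap {ξ : ZMod p × ZMod (p ^ (m + 1)) → ZMod p} {K : Finset ℕ}
    {B : Finset (ZMod p × ZMod (p ^ (m + 1)))}
    (h : ∀ b ∈ B, ∀ b' ∈ B, b ≠ b' → ξ b = ξ b' → ∃ k ∈ K, ∃ w : ℤ, (w : ZMod p) ≠ 0 ∧
      (b - b').2 = w * (p : ZMod (p ^ (m + 1))) ^ (m - k)) :
    Set.InjOn (digitMap ξ K) B := by
  intro b hb b' hb' heq
  by_contra hne
  simp only [digitMap, Prod.mk.injEq] at heq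
  obtain ⟨k, hk, w, hw, hbw⟩ := h b hb b' hb' hne heq.1
  have h1 := digit_sub_digit_self (Nat.sub_le m k) hbw
  rw [congrFun heq.2 ⟨k, hk⟩, sub_self] at h1
  exact hw h1.symm

lemma card_codomain_digitMap (K : Finset ℕ) :
    Fintype.card (ZMod p × (K → ZMod p)) = p ^ (#K + 1) := by
  simp only [Fintype.card_prod, ZMod.card, Fintype.card_fun, Fintype.card_coe]
  ring

lemma card_le_of_injOn_digitMap {ξ : ZMod p × ZMod (p ^ (m + 1)) → ZMod p} {K : Finset ℕ}
    {B : Finset (ZMod p × ZMod (p ^ (m + 1)))} (h : Set.InjOn (digitMap ξ K) B) :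
    #B ≤ p ^ (#K + 1) := by
  rw [← card_codomain_digitMap, ← Finset.card_univ]
  exact Finset.card_le_card_of_injOn _ (fun _ _ => Finset.mem_univ _) h

/-- Downward sweep over the levels, with `e` the number of factors `p` already gained and `B` the
part of the spectrum still in play. At each level the zeros either occur for all slopes, or for
none, or for some only; the last case ends the sweep, because the lower bound on `#A` from
divisibility meets the upper bound from `B`. -/
lemma card_eq_pow_of_levels {A : Finset (ZMod p × ZMod (p ^ (m + 1)))} (hA : A.Nonempty)
    {j : ℕ} (hj : j ≤ m + 1) (e : ℕ) (B : Finset (ZMod p × ZMod (p ^ (m + 1))))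
    (hdiv : ∀ x y, p ^ e ∣ cell A j x y) (hle : #A ≤ p ^ e * #B)
    (hB : ∀ b ∈ B, ∀ b' ∈ B, b ≠ b' → hat A (b - b') = 0)
    (hlev : ∀ b ∈ B, ∀ b' ∈ B, b ≠ b' → (b - b').2 = 0 ∨ ∃ k < j, ∃ w : ℤ, (w : ZMod p) ≠ 0 ∧
      (b - b').2 = w * (p : ZMod (p ^ (m + 1))) ^ (m - k)) :
    ∃ s, #A = p ^ s := by
  have hp : p.Prime := Fact.out
  induction j generalizing e B with
  | zero =>
    have hsnd : ∀ b ∈ B, ∀ b' ∈ B, b ≠ b' → (b - b').2 = 0 := by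
      intro b hb b' hb' hne
      rcases hlev b hb b' hb' hne with h | ⟨k, hk, -⟩
      · exact h
      · omega
    rcases le_or_gt #B 1 with hB1 | hB1
    · refine ⟨e, Nat.le_antisymm (hle.trans (by nlinarith [pow_pos hp.pos e])) ?_⟩
      refine Nat.le_of_dvd hA.card_pos ?_
      rw [← sum_cell_zero A 0]
      exact Finset.dvd_sum fun x _ => hdiv x 0
    · obtain ⟨b, hb, b', hb', hne⟩ := Finset.one_lt_card.1 hB1
      have h1 := hB b hb b' hb' hne
      have h2 := hsnd b hb b' hb' hne
      have h3 : (b - b').1 ≠ 0 := fun h3 => hne (sub_eq_zero.1 (Prod.ext h3 h2))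
      rw [hat_eq_zero_iff_of_snd_eq_zero h3 h2] at h1
      refine ⟨e + 1, Nat.le_antisymm ?_ ?_⟩
      · rw [pow_succ p e]
        refine hle.trans (Nat.mul_le_mul_left _ ?_)
        calc #B ≤ #(Finset.univ : Finset (ZMod p)) := by
              refine Finset.card_le_card_of_injOn Prod.fst (fun _ _ => Finset.mem_univ _) ?_
              intro b hb b' hb' heq
              by_contra hne
              have h4 := hsnd b hb b' hb' hne
              exact hne (Prod.ext heq (sub_eq_zero.1 h4))
          _ = p := by rw [Finset.card_univ, ZMod.card]
      · refine Nat.le_of_dvd hA.card_pos ?_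
        rw [← mul_cell_zero h1 0 0, pow_succ']
        exact Nat.mul_dvd_mul_left p (hdiv 0 0)
  | succ j ih =>
    by_cases hfull : ∀ c, hat A (levelElt c j) = 0
    -- All slopes vanish: cells gain a factor `p`, and keeping only the most frequent digit at this
    -- level loses at most a factor `p` of `B` while removing differences of level `j`.
    · obtain ⟨d, -, hd⟩ := Finset.exists_max_image (Finset.univ : Finset (ZMod p))
        (fun d => #{b ∈ B | digit (m - j) b = d}) Finset.univ_nonempty
      have hcard : #B ≤ p * #{b ∈ B | digit (m - j) b = d} := by
        rw [Finset.card_eq_sum_card_fiberwise (t := Finset.univ) (f := digit (m - j)) (s := B)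
          (by simp)]
        refine (Finset.sum_le_card_nsmul _ _ _ hd).trans ?_
        simp [ZMod.card]
      refine ih (by omega) (e + 1) {b ∈ B | digit (m - j) b = d} ?_ ?_ ?_ ?_
      · intro x y
        rw [← mul_cell_succ (by omega) hfull, pow_succ']
        exact Nat.mul_dvd_mul_left p (hdiv x y)
      · rw [pow_succ p e, mul_assoc]
        exact hle.trans (Nat.mul_le_mul_left _ hcard)
      · intro b hb b' hb'
        exact hB b (Finset.mem_filter.1 hb).1 b' (Finset.mem_filter.1 hb').1
      · intro b hb b' hb' hne
        rw [Finset.mem_filter] at hb hb'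
        rcases hlev b hb.1 b' hb'.1 hne with h | ⟨k, hk, w, hw, hbw⟩
        · exact Or.inl h
        · refine Or.inr ⟨k, ?_, w, hw, hbw⟩
          refine lt_of_le_of_ne (by omega) ?_
          rintro rfl
          have h1 := digit_sub_digit_self (Nat.sub_le m k) hbw
          rw [hb.2, hb'.2, sub_self] at h1
          exact hw h1.symm
    · by_cases hempty : ∀ c, hat A (levelElt c j) ≠ 0
      · refine ih (by omega) e B (dvd_cell_of_dvd_cell_succ hdiv) hle hB ?_
        intro b hb b' hb' hne
        rcases hlev b hb b' hb' hne with h | ⟨k, hk, w, hw, hbw⟩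
        · exact Or.inl h
        · refine Or.inr ⟨k, ?_, w, hw, hbw⟩
          refine lt_of_le_of_ne (by omega) ?_
          rintro rfl
          exact hempty _ ((hat_eq_zero_iff_levelElt hw hbw).1 (hB b hb b' hb' hne))
      · push Not at hfull hempty
        obtain ⟨c', hc'⟩ := hfull
        obtain ⟨c, hc⟩ := hempty
        have hdvd : p ^ (e + 1) * p ^ #(zeroLevels A j) ∣ #A := by
          refine mul_pow_card_zeroLevels_dvd (by omega) fun y => ?_
          rw [← mul_sum_subcell (by omega) hc y 0, pow_succ']
          exact Nat.mul_dvd_mul_left p (Finset.dvd_sum fun x _ => dvd_subcell hdiv _ _ _)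
        -- Equality of the first component for a difference of level `j` would give it slope `c'`,
        -- where `hat A` does not vanish; for lower levels it means slope `0`.
        have hinj : Set.InjOn (digitMap (fun b => b.1 - c' * digit (m - j) b) (zeroLevels A j))
            (B : Set (ZMod p × ZMod (p ^ (m + 1)))) := by
          refine injOn_digitMap fun b hb b' hb' hne hξ => ?_
          have hzero := hB b hb b' hb' hne
          rcases hlev b hb b' hb' hne with h | ⟨k, hk, w, hw, hbw⟩
          · rw [digit_eq_digit_of_snd _ h] at hξ
            exact absurd (Prod.ext (sub_left_inj.1 hξ) (sub_eq_zero.1 h)) hne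
          · have h2 := (hat_eq_zero_iff_levelElt hw hbw).1 hzero
            rcases Nat.lt_succ_iff_lt_or_eq.1 hk with hkj | rfl
            · rw [digit_eq_digit (Nat.sub_le m k) (by omega) hbw] at hξ
              refine ⟨k, mem_zeroLevels.2 ⟨hkj, ?_⟩, w, hw, hbw⟩
              rwa [Prod.fst_sub, sub_left_inj.1 hξ, sub_self, zero_div] at h2
            · have h3 := digit_sub_digit_self (Nat.sub_le m k) hbw
              have h4 : (b - b').1 / (w : ZMod p) = c' := by
                rw [div_eq_iff hw, ← h3, Prod.fst_sub]
                linear_combination hξ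
              rw [h4] at h2
              exact absurd h2 hc'
        have hcard := card_le_of_injOn_digitMap hinj
        refine ⟨e + 1 + #(zeroLevels A j), Nat.le_antisymm ?_ ?_⟩
        · refine hle.trans ((Nat.mul_le_mul_left _ hcard).trans (le_of_eq ?_))
          ring
        · rw [pow_add]
          exact Nat.le_of_dvd hA.card_pos hdvd

lemma sub_snd_eq_zero_or_exists_level {b b' : ZMod p × ZMod (p ^ (m + 1))} :
    (b - b').2 = 0 ∨ ∃ k < m + 1, ∃ w : ℤ, (w : ZMod p) ≠ 0 ∧
      (b - b').2 = w * (p : ZMod (p ^ (m + 1))) ^ (m - k) := by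
  by_cases h : (b - b').2 = 0
  · exact Or.inl h
  · obtain ⟨k, hk, h⟩ := exists_level h
    exact Or.inr ⟨k, by omega, h⟩

/-- The cardinality of a spectral set is a power of `p`. -/
lemma card_eq_pow_of_spectrum {A B : Finset (ZMod p × ZMod (p ^ (m + 1)))} (hA : A.Nonempty)
    (hcard : #B = #A) (hB : ∀ b ∈ B, ∀ b' ∈ B, b ≠ b' → hat A (b - b') = 0) :
    ∃ s, #A = p ^ s :=
  card_eq_pow_of_levels hA le_rfl 0 B (by simp) (by simp [hcard]) hB
    fun _ _ _ _ _ => sub_snd_eq_zero_or_exists_level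

/-- Distinct points of `B` with equal first coordinate differ by an element of slope `0`, whose
level is then a zero level. -/
lemma injOn_digitMap_of_spectrum {A B : Finset (ZMod p × ZMod (p ^ (m + 1)))}
    (hB : ∀ b ∈ B, ∀ b' ∈ B, b ≠ b' → hat A (b - b') = 0) :
    Set.InjOn (digitMap Prod.fst (zeroLevels A (m + 1)))
      (B : Set (ZMod p × ZMod (p ^ (m + 1)))) := by
  refine injOn_digitMap fun b hb b' hb' hne hξ => ?_
  have hzero := hB b hb b' hb' hne
  rcases sub_snd_eq_zero_or_exists_level (b := b) (b' := b') with h | ⟨k, hk, w, hw, hbw⟩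
  · exact absurd (Prod.ext hξ (sub_eq_zero.1 h)) hne
  · refine ⟨k, mem_zeroLevels.2 ⟨hk, ?_⟩, w, hw, hbw⟩
    have h2 := (hat_eq_zero_iff_levelElt hw hbw).1 hzero
    rwa [Prod.fst_sub, hξ, sub_self, zero_div] at h2

end Digits

/-! ### Constructing tilings and spectra -/

section DigitSums

variable {p m : ℕ}

lemma pairing_eq_of_mul_eq_zero {g h : ZMod p × ZMod (p ^ (m + 1))} (hgh : g.2 * h.2 = 0) :
    pairing p (m + 1) g h =
      (p : ZMod (p ^ (m + 1))) ^ m * ((g.1.val * h.1.val : ℤ) : ZMod (p ^ (m + 1))) := by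
  rw [pairing, hgh, Nat.add_sub_cancel]
  push_cast
  ring

lemma pairing_eq_of_same_level {g h : ZMod p × ZMod (p ^ (m + 1))} {k : ℕ} (hk : k ≤ m) {w : ℤ}
    (hg : g.2 = w * (p : ZMod (p ^ (m + 1))) ^ (m - k))
    (hh : h.2 = (p : ZMod (p ^ (m + 1))) ^ k) :
    pairing p (m + 1) g h =
      (p : ZMod (p ^ (m + 1))) ^ m * ((g.1.val * h.1.val + w : ℤ) : ZMod (p ^ (m + 1))) := by
  rw [pairing, hg, hh, Nat.add_sub_cancel, mul_assoc, ← pow_add, Nat.sub_add_cancel hk]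
  push_cast
  ring

lemma mul_eq_zero_of_level_lt {k l : ℕ} (hk : k ≤ m) (hl : k < l) (w : ZMod (p ^ (m + 1))) :
    w * (p : ZMod (p ^ (m + 1))) ^ (m - k) * (p : ZMod (p ^ (m + 1))) ^ l = 0 := by
  rw [mul_assoc, ← pow_add, show m - k + l = (m + 1) + (l - k - 1) by omega,
    pow_add (p : ZMod (p ^ (m + 1))),
    ← Nat.cast_pow p (m + 1), ZMod.natCast_self, zero_mul, mul_zero]

/-- The difference of two digit vectors, with a default value outside of `K`. -/
def digitDiff {K : Finset ℕ} (d d' : K → ZMod p) (e : ℤ) (k : ℕ) : ℤ :=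
  if h : k ∈ K then ((d ⟨k, h⟩).val : ℤ) - (d' ⟨k, h⟩).val else e

lemma sum_digits_sub {K : Finset ℕ} (d d' : K → ZMod p) (e : ℤ) :
    ∑ k : K, ((d k).val : ZMod (p ^ (m + 1))) * (p : ZMod (p ^ (m + 1))) ^ (m - (k : ℕ)) -
      ∑ k : K, ((d' k).val : ZMod (p ^ (m + 1))) * (p : ZMod (p ^ (m + 1))) ^ (m - (k : ℕ)) =
    ∑ k ∈ K, (digitDiff d d' e k : ZMod (p ^ (m + 1))) *
      (p : ZMod (p ^ (m + 1))) ^ (m - k) := by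
  rw [← Finset.sum_sub_distrib, ← Finset.sum_coe_sort K]
  refine Finset.sum_congr rfl fun k _ => ?_
  simp only [digitDiff, k.2, dif_pos]
  push_cast
  ring

end DigitSums

section Constructions

variable {p m : ℕ} [Fact p.Prime]

/-- The vanishing condition on the Fourier transform of a set `A` of cardinality
`p ^ (#(zeroLevels A (m + 1)) + 1)` that makes it both a tile and a spectral set. -/
def HasTwist (A : Finset (ZMod p × ZMod (p ^ (m + 1)))) : Prop :=
  (hat A (1, 0) = 0 ∧ ∀ k ∈ zeroLevels A (m + 1), ∀ c, hat A (levelElt c k) = 0) ∨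
    ∃ κ < m + 1, κ ∉ zeroLevels A (m + 1) ∧ ∃ c ≠ 0, hat A (levelElt c κ) = 0 ∧
      ∀ k ∈ zeroLevels A (m + 1), κ < k → ∀ c, hat A (levelElt c k) = 0

lemma zeroLevels_subset_range (A : Finset (ZMod p × ZMod (p ^ (m + 1)))) (j : ℕ) :
    zeroLevels A j ⊆ Finset.range j := Finset.filter_subset _ _

lemma card_zeroLevels_compl (A : Finset (ZMod p × ZMod (p ^ (m + 1)))) :
    #(Finset.range (m + 1) \ zeroLevels A (m + 1)) + #(zeroLevels A (m + 1)) = m + 1 := by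
  rw [Finset.card_sdiff_add_card_eq_card (zeroLevels_subset_range A _), Finset.card_range]

/-- The complement is generated by `(1, 0)`, which handles `g.1 ≠ 0`, and by `(0, p ^ l)` for the
levels `l` at which slope `0` is not a zero. -/
lemma isTile_of_card_eq {A : Finset (ZMod p × ZMod (p ^ (m + 1)))}
    (hcard : #A = p ^ #(zeroLevels A (m + 1))) : IsTile A := by
  have hK := card_zeroLevels_compl A
  refine isTile_of_digit_sums (L := Option ↥(Finset.range (m + 1) \ zeroLevels A (m + 1)))
    (fun l => l.elim (1, 0) fun l => (0, (p : ZMod (p ^ (m + 1))) ^ (l : ℕ))) ?_ ?_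
  · rw [hcard, Fintype.card_option, Fintype.card_coe, ← pow_add]
    congr 1
    omega
  · intro g hg
    by_cases h1 : g.1 = 0
    · obtain ⟨k, hk, w, hw, hgw⟩ := exists_level (x := g.2) fun h2 => hg (Prod.ext h1 h2)
      by_cases hkA : k ∈ zeroLevels A (m + 1)
      · left
        rw [hat_eq_zero_iff_levelElt hw hgw, h1, zero_div]
        exact (mem_zeroLevels.1 hkA).2
      · refine Or.inr ⟨some ⟨k, Finset.mem_sdiff.2 ⟨Finset.mem_range.2 (by omega), hkA⟩⟩, _, ?_,
          pairing_eq_of_same_level hk hgw rfl⟩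
        simpa [h1] using hw
    · refine Or.inr ⟨none, _, ?_, pairing_eq_of_mul_eq_zero (by simp)⟩
      simpa using h1

lemma isTile_of_hasTwist {A : Finset (ZMod p × ZMod (p ^ (m + 1)))}
    (hcard : #A = p ^ (#(zeroLevels A (m + 1)) + 1)) (h : HasTwist A) : IsTile A := by
  have hK := card_zeroLevels_compl A
  have hcard' : #A * p ^ Fintype.card ↥(Finset.range (m + 1) \ zeroLevels A (m + 1)) =
      p ^ (m + 2) := by
    rw [hcard, Fintype.card_coe, ← pow_add]
    congr 1
    omega
  rcases h with ⟨h10, hfull⟩ | ⟨κ, hκm, hκ, c, hc0, hc, hfull⟩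
  · refine isTile_of_digit_sums
      (fun l : ↥(Finset.range (m + 1) \ zeroLevels A (m + 1)) =>
        (0, (p : ZMod (p ^ (m + 1))) ^ (l : ℕ))) hcard' ?_
    intro g hg
    by_cases h2 : g.2 = 0
    · left
      rwa [hat_eq_zero_iff_of_snd_eq_zero (fun h1 => hg (Prod.ext h1 h2)) h2]
    · obtain ⟨k, hk, w, hw, hgw⟩ := exists_level h2
      by_cases hkA : k ∈ zeroLevels A (m + 1)
      · left
        rw [hat_eq_zero_iff_levelElt hw hgw]
        exact hfull k hkA _
      · refine Or.inr ⟨⟨k, Finset.mem_sdiff.2 ⟨Finset.mem_range.2 (by omega), hkA⟩⟩, _, ?_,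
          pairing_eq_of_same_level hk hgw rfl⟩
        simpa using hw
  · have hκmem : κ ∈ Finset.range (m + 1) \ zeroLevels A (m + 1) :=
      Finset.mem_sdiff.2 ⟨Finset.mem_range.2 hκm, hκ⟩
    -- The generator of level `κ` is tilted to `(-c⁻¹, p ^ κ)`. At level `κ` it misses only slope
    -- `c`, where `hat A` vanishes; it also detects every `g` with `g.1 ≠ 0` that has level below
    -- `κ` or zero second coordinate.
    refine isTile_of_digit_sums
      (fun l : ↥(Finset.range (m + 1) \ zeroLevels A (m + 1)) => (if (l : ℕ) = κ then -c⁻¹ else 0,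
      (p : ZMod (p ^ (m + 1))) ^ (l : ℕ))) hcard' ?_
    intro g hg
    by_cases h2 : g.2 = 0
    · refine Or.inr ⟨⟨κ, hκmem⟩, _, ?_, pairing_eq_of_mul_eq_zero (by simp [h2])⟩
      have h1 : g.1 ≠ 0 := fun h1 => hg (Prod.ext h1 h2)
      simp [h1, hc0]
    · obtain ⟨k, hk, w, hw, hgw⟩ := exists_level h2
      by_cases hkA : k ∈ zeroLevels A (m + 1)
      · rcases lt_trichotomy k κ with hlt | rfl | hlt
        · by_cases h1 : g.1 = 0
          · left
            rw [hat_eq_zero_iff_levelElt hw hgw, h1, zero_div]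
            exact (mem_zeroLevels.1 hkA).2
          · refine Or.inr ⟨⟨κ, hκmem⟩, _, ?_, pairing_eq_of_mul_eq_zero ?_⟩
            · simp [h1, hc0]
            · rw [hgw]
              exact mul_eq_zero_of_level_lt hk hlt _
        · exact absurd hkA hκ
        · left
          rw [hat_eq_zero_iff_levelElt hw hgw]
          exact hfull k hkA hlt _
      · by_cases hkκ : k = κ
        · subst hkκ
          by_cases hgc : g.1 / (w : ZMod p) = c
          · left
            rwa [hat_eq_zero_iff_levelElt hw hgw, hgc]
          · refine Or.inr ⟨⟨k, hκmem⟩, _, ?_, pairing_eq_of_same_level hk hgw rfl⟩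
            intro hcon
            apply hgc
            simp only [if_true] at hcon
            push_cast at hcon
            rw [ZMod.natCast_zmod_val, ZMod.natCast_zmod_val] at hcon
            field_simp at hcon ⊢
            linear_combination -hcon
        · refine Or.inr ⟨⟨k, Finset.mem_sdiff.2 ⟨Finset.mem_range.2 (by omega), hkA⟩⟩, _, ?_,
            pairing_eq_of_same_level hk hgw rfl⟩
          simpa [hkκ] using hw

/-- The largest `k` with `D k ≠ 0` carries the smallest power of `p`, so it alone determines the
leading coefficient modulo `p`. -/
lemma exists_level_sum {S : Finset ℕ} (hS : ∀ k ∈ S, k ≤ m) {D : ℕ → ℤ}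
    (hD : ∃ k ∈ S, D k ≠ 0) :
    ∃ k₀ ∈ S, D k₀ ≠ 0 ∧ (∀ k ∈ S, k₀ < k → D k = 0) ∧ ∃ w : ℤ, (w : ZMod p) = D k₀ ∧
      ∑ k ∈ S, (D k : ZMod (p ^ (m + 1))) * (p : ZMod (p ^ (m + 1))) ^ (m - k) =
        w * (p : ZMod (p ^ (m + 1))) ^ (m - k₀) := by
  obtain ⟨k₁, hk₁, hDk₁⟩ := hD
  obtain ⟨k₀, hk₀, hmax⟩ := Finset.exists_max_image {k ∈ S | D k ≠ 0} id
    ⟨k₁, Finset.mem_filter.2 ⟨hk₁, hDk₁⟩⟩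
  rw [Finset.mem_filter] at hk₀
  have hz : ∀ k ∈ S, k₀ < k → D k = 0 := by
    intro k hk hlt
    by_contra hne
    exact absurd (hmax k (Finset.mem_filter.2 ⟨hk, hne⟩)) (not_le.2 hlt)
  refine ⟨k₀, hk₀.1, hk₀.2, hz, ∑ k ∈ S, D k * (p : ℤ) ^ (k₀ - k), ?_, ?_⟩
  · push_cast
    rw [Finset.sum_eq_single k₀]
    · simp
    · intro k hk hne
      rcases lt_or_gt_of_ne hne with hlt | hlt
      · rw [CharP.cast_eq_zero, zero_pow (by omega), mul_zero]
      · rw [hz k hk hlt, Int.cast_zero, zero_mul]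
    · exact fun h => absurd hk₀.1 h
  · push_cast
    rw [Finset.sum_mul]
    refine Finset.sum_congr rfl fun k hk => ?_
    rcases le_or_gt k k₀ with hle | hlt
    · rw [mul_assoc, ← pow_add]
      congr 2
      have := hS k₀ hk₀.1
      omega
    · simp [hz k hk hlt]

lemma le_of_mem_zeroLevels {A : Finset (ZMod p × ZMod (p ^ (m + 1)))} {k : ℕ}
    (hk : k ∈ zeroLevels A (m + 1)) : k ≤ m := Nat.lt_succ_iff.1 (mem_zeroLevels.1 hk).1

lemma digitDiff_cast_ne_zero {K : Finset ℕ} {d d' : K → ZMod p} {e : ℤ} {k : ℕ} (hk : k ∈ K)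
    (h : digitDiff d d' e k ≠ 0) : (digitDiff d d' e k : ZMod p) ≠ 0 := by
  simp only [digitDiff, hk, dif_pos] at h ⊢
  push_cast
  rw [ZMod.natCast_zmod_val, ZMod.natCast_zmod_val, sub_ne_zero]
  intro h'
  exact h (by rw [h', sub_self])

lemma exists_digitDiff_ne_zero {K : Finset ℕ} {d d' : K → ZMod p} (e : ℤ) (h : d ≠ d') :
    ∃ k ∈ K, digitDiff d d' e k ≠ 0 := by
  obtain ⟨k, hk⟩ := Function.ne_iff.1 h
  refine ⟨k, k.2, ?_⟩
  simp only [digitDiff, k.2, dif_pos]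
  rw [sub_ne_zero]
  exact fun h' => hk (ZMod.val_injective _ (by exact_mod_cast h'))

/-- The spectrum has first coordinate `0` and free digits at the zero levels, so its nonzero
differences have slope `0` at such a level. -/
lemma isSpectral_of_card_eq {A : Finset (ZMod p × ZMod (p ^ (m + 1)))} (hA : A.Nonempty)
    (hcard : #A = p ^ #(zeroLevels A (m + 1))) : IsSpectral p (m + 1) A := by
  refine isSpectral_of_hat_sub_eq_zero hA (J := zeroLevels A (m + 1) → ZMod p)
    (by simp [ZMod.card, hcard])
    (fun d => (0, ∑ k, ((d k).val : ZMod (p ^ (m + 1))) *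
      (p : ZMod (p ^ (m + 1))) ^ (m - (k : ℕ)))) fun d d' hne => ?_
  obtain ⟨k₀, hk₀, hD, -, w, hw, hsum⟩ := exists_level_sum (p := p) (m := m)
    (fun k hk => le_of_mem_zeroLevels hk) (exists_digitDiff_ne_zero 0 hne)
  rw [Prod.mk_sub_mk, sum_digits_sub d d' 0, hsum,
    hat_eq_zero_iff_levelElt (hw ▸ digitDiff_cast_ne_zero hk₀ hD) rfl, sub_self, zero_div]
  exact (mem_zeroLevels.1 hk₀).2

lemma isSpectral_of_hasTwist {A : Finset (ZMod p × ZMod (p ^ (m + 1)))} (hA : A.Nonempty)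
    (hcard : #A = p ^ (#(zeroLevels A (m + 1)) + 1)) (h : HasTwist A) :
    IsSpectral p (m + 1) A := by
  have hJ : Fintype.card (ZMod p × (zeroLevels A (m + 1) → ZMod p)) = #A := by
    rw [card_codomain_digitMap, hcard]
  rcases h with ⟨h10, hfull⟩ | ⟨κ, hκm, hκ, c, hc0, hc, hfull⟩
  · refine isSpectral_of_hat_sub_eq_zero hA hJ
      (fun j => (j.1, ∑ k, ((j.2 k).val : ZMod (p ^ (m + 1))) *
        (p : ZMod (p ^ (m + 1))) ^ (m - (k : ℕ)))) ?_
    rintro ⟨x, d⟩ ⟨x', d'⟩ hne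
    by_cases hd : d = d'
    · subst hd
      have hx : x - x' ≠ 0 := sub_ne_zero.2 fun hx => hne (by rw [hx])
      rw [Prod.mk_sub_mk, hat_eq_zero_iff_of_snd_eq_zero hx (sub_self _)]
      exact h10
    · obtain ⟨k₀, hk₀, hD, -, w, hw, hsum⟩ := exists_level_sum (p := p) (m := m)
        (fun k hk => le_of_mem_zeroLevels hk) (exists_digitDiff_ne_zero 0 hd)
      rw [Prod.mk_sub_mk, sum_digits_sub d d' 0, hsum,
        hat_eq_zero_iff_levelElt (hw ▸ digitDiff_cast_ne_zero hk₀ hD) rfl]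
      exact hfull k₀ hk₀ _
  -- The first coordinate `x` is tied to the coefficient `x * c⁻¹` at level `κ`, so that a
  -- difference of leading level `κ` has slope `c`.
  · refine isSpectral_of_hat_sub_eq_zero hA hJ
      (fun j => (j.1, ((j.1.val * c⁻¹.val : ℤ) : ZMod (p ^ (m + 1))) *
        (p : ZMod (p ^ (m + 1))) ^ (m - κ) + ∑ k, ((j.2 k).val : ZMod (p ^ (m + 1))) *
        (p : ZMod (p ^ (m + 1))) ^ (m - (k : ℕ)))) ?_
    rintro ⟨x, d⟩ ⟨x', d'⟩ hne
    set e : ℤ := ((x.val : ℤ) - x'.val) * c⁻¹.val with he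
    have hecast : (e : ZMod p) = (x - x') * c⁻¹ := by
      rw [he]
      push_cast
      simp only [ZMod.natCast_zmod_val]
    have heκ : digitDiff d d' e κ = e := by simp [digitDiff, hκ]
    have he0 : e = 0 → x = x' := by
      intro h0
      rw [h0, Int.cast_zero] at hecast
      exact sub_eq_zero.1 ((mul_eq_zero.1 hecast.symm).resolve_right (inv_ne_zero hc0))
    -- As `κ` is not a zero level, the default value `e` of `digitDiff` serves as the coefficient at
    -- `κ`.
    have hD : ∃ k ∈ insert κ (zeroLevels A (m + 1)), digitDiff d d' e k ≠ 0 := by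
      by_cases hd : d = d'
      · refine ⟨κ, Finset.mem_insert_self _ _, ?_⟩
        rw [heκ]
        exact fun h0 => hne (by rw [hd, he0 h0])
      · obtain ⟨k, hk, hk'⟩ := exists_digitDiff_ne_zero e hd
        exact ⟨k, Finset.mem_insert_of_mem hk, hk'⟩
    have hS : ∀ k ∈ insert κ (zeroLevels A (m + 1)), k ≤ m := by
      intro k hk
      rcases Finset.mem_insert.1 hk with rfl | hk
      · omega
      · exact le_of_mem_zeroLevels hk
    obtain ⟨k₀, hk₀, hDk, hz, w, hw, hsum⟩ := exists_level_sum (p := p) (m := m) hS hD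
    have hdiff : ((x, ((x.val * c⁻¹.val : ℤ) : ZMod (p ^ (m + 1))) *
        (p : ZMod (p ^ (m + 1))) ^ (m - κ) + ∑ k, ((d k).val : ZMod (p ^ (m + 1))) *
        (p : ZMod (p ^ (m + 1))) ^ (m - (k : ℕ))) - (x', ((x'.val * c⁻¹.val : ℤ) :
        ZMod (p ^ (m + 1))) * (p : ZMod (p ^ (m + 1))) ^ (m - κ) +
        ∑ k, ((d' k).val : ZMod (p ^ (m + 1))) * (p : ZMod (p ^ (m + 1))) ^ (m - (k : ℕ))) :
        ZMod p × ZMod (p ^ (m + 1))) =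
        (x - x', w * (p : ZMod (p ^ (m + 1))) ^ (m - k₀)) := by
      rw [← hsum, Finset.sum_insert hκ, ← sum_digits_sub d d' e, heκ, he, Prod.mk_sub_mk]
      congr 1
      push_cast
      ring
    rw [hdiff]
    by_cases hk₀κ : k₀ = κ
    · subst hk₀κ
      rw [heκ, hecast] at hw
      rw [heκ] at hDk
      have hx : x - x' ≠ 0 := by
        rw [sub_ne_zero]
        rintro rfl
        exact hDk (by rw [he, sub_self, zero_mul])
      have hw0 : (w : ZMod p) ≠ 0 := by
        rw [hw]
        exact mul_ne_zero hx (inv_ne_zero hc0)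
      rw [hat_eq_zero_iff_levelElt hw0 rfl]
      have h1 : (x - x') / (w : ZMod p) = c := by
        rw [div_eq_iff hw0, hw]
        field_simp
      rw [h1]
      exact hc
    · have hk₀' := Finset.mem_of_mem_insert_of_ne hk₀ hk₀κ
      rw [hat_eq_zero_iff_levelElt (hw ▸ digitDiff_cast_ne_zero hk₀' hDk) rfl]
      -- Below `κ` the coefficient at `κ` is zero, hence `x = x'` and the slope is `0`; above `κ`
      -- every slope is a zero.
      rcases lt_or_gt_of_ne hk₀κ with hlt | hlt
      · have h0 := hz κ (Finset.mem_insert_self _ _) hlt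
        rw [heκ] at h0
        rw [he0 h0, sub_self, zero_div]
        exact (mem_zeroLevels.1 hk₀').2
      · exact hfull k₀ hk₀' hlt _

end Constructions

/-! ### Spectral sets are tiles -/

section Main

variable {p m : ℕ} [Fact p.Prime]

/-- By cardinality the injective digit map on `B` is a bijection, so points of `B` exist with any
prescribed first coordinate and digits. Two with zero digits and first coordinates `0` and `1`
exhibit the twist. -/
lemma hasTwist_of_spectrum {A B : Finset (ZMod p × ZMod (p ^ (m + 1)))}
    (hcard : #B = p ^ (#(zeroLevels A (m + 1)) + 1))
    (hB : ∀ b ∈ B, ∀ b' ∈ B, b ≠ b' → hat A (b - b') = 0) : HasTwist A := by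
  classical
  have hsurj : ∀ (x : ZMod p) (δ : zeroLevels A (m + 1) → ZMod p), ∃ b ∈ B, b.1 = x ∧
      ∀ k : zeroLevels A (m + 1), digit (m - k) b = δ k := by
    intro x δ
    have h1 : B.image (digitMap Prod.fst (zeroLevels A (m + 1))) = Finset.univ := by
      refine Finset.eq_univ_of_card _ ?_
      rw [Finset.card_image_of_injOn (injOn_digitMap_of_spectrum hB), hcard,
        card_codomain_digitMap]
    have h2 : (x, δ) ∈ B.image (digitMap Prod.fst (zeroLevels A (m + 1))) := by
      rw [h1]; exact Finset.mem_univ _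
    obtain ⟨b, hb, hbx⟩ := Finset.mem_image.1 h2
    simp only [digitMap, Prod.mk.injEq] at hbx
    exact ⟨b, hb, hbx.1, fun k => congrFun hbx.2 k⟩
  obtain ⟨b, hb, hb1, hbd⟩ := hsurj 0 0
  obtain ⟨b', hb', hb'1, hb'd⟩ := hsurj 1 0
  have hfst : (b - b').1 = -1 := by rw [Prod.fst_sub, hb1, hb'1, zero_sub]
  have hne : b ≠ b' := by
    rintro rfl
    rw [sub_self] at hfst
    exact neg_ne_zero.2 one_ne_zero hfst.symm
  -- The extra factor `p` makes `b - b'` invisible to the digit `m - k`.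
  have hfull : ∀ k ∈ zeroLevels A (m + 1), ∀ t : ℤ,
      (b - b').2 = t * p * (p : ZMod (p ^ (m + 1))) ^ (m - k) →
      ∀ c, hat A (levelElt c k) = 0 := by
    intro k hk t ht c
    by_cases hc : c = 0
    · rw [hc]
      exact (mem_zeroLevels.1 hk).2
    -- With this digit, `b₂ - b'` has level `k` and slope `(0 - 1) / (-c⁻¹) = c`.
    obtain ⟨b₂, hb₂, hb₂1, hb₂d⟩ := hsurj 0 (Function.update 0 ⟨k, hk⟩ (-c⁻¹))
    have hc' : -c⁻¹ ≠ 0 := neg_ne_zero.2 (inv_ne_zero hc)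
    have hne₂ : b₂ ≠ b := by
      rintro rfl
      have := hb₂d ⟨k, hk⟩
      rw [hbd, Function.update_self] at this
      exact hc' this.symm
    obtain ⟨k₂, hk₂, w, hw, hbw⟩ : ∃ k₂ < m + 1, ∃ w : ℤ, (w : ZMod p) ≠ 0 ∧
        (b₂ - b).2 = w * (p : ZMod (p ^ (m + 1))) ^ (m - k₂) := by
      rcases sub_snd_eq_zero_or_exists_level (b := b₂) (b' := b) with h | h
      · exact absurd (Prod.ext (hb₂1.trans hb1.symm) (sub_eq_zero.1 h)) hne₂
      · exact h
    have hk₂mem : k₂ ∈ zeroLevels A (m + 1) := by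
      refine mem_zeroLevels.2 ⟨hk₂, ?_⟩
      have h1 := (hat_eq_zero_iff_levelElt hw hbw).1 (hB b₂ hb₂ b hb hne₂)
      rwa [Prod.fst_sub, hb₂1, hb1, sub_self, zero_div] at h1
    have hdig := digit_sub_digit_self (Nat.sub_le m k₂) hbw
    rw [hb₂d ⟨k₂, hk₂mem⟩, hbd ⟨k₂, hk₂mem⟩, Pi.zero_apply, sub_zero] at hdig
    have hkk : k₂ = k := by
      by_contra hkk
      rw [Function.update_of_ne (by simpa using hkk), Pi.zero_apply] at hdig
      exact hw hdig.symm
    subst hkk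
    rw [Function.update_self] at hdig
    have hcast : ((w + t * p : ℤ) : ZMod p) = -c⁻¹ := by
      push_cast
      rw [hdig, CharP.cast_eq_zero, mul_zero, add_zero]
    have hsnd : (b₂ - b').2 = ((w + t * p : ℤ) : ZMod (p ^ (m + 1))) *
        (p : ZMod (p ^ (m + 1))) ^ (m - k₂) := by
      rw [← sub_add_sub_cancel b₂ b b', Prod.snd_add, hbw, ht]
      push_cast
      ring
    have hne' : b₂ ≠ b' := by
      rintro rfl
      rw [hb'1] at hb₂1
      exact one_ne_zero hb₂1
    have h1 := (hat_eq_zero_iff_levelElt (hcast ▸ hc') hsnd).1 (hB b₂ hb₂ b' hb' hne')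
    rwa [Prod.fst_sub, hb₂1, hb'1, hcast, zero_sub, neg_div_neg_eq, one_div, inv_inv] at h1
  have hzero := hB b hb b' hb' hne
  rcases sub_snd_eq_zero_or_exists_level (b := b) (b' := b') with h | ⟨κ, hκm, w, hw, hbw⟩
  · refine Or.inl ⟨?_, fun k hk => hfull k hk 0 (by simpa using h)⟩
    rwa [hat_eq_zero_iff_of_snd_eq_zero (by rw [hfst]; exact neg_ne_zero.2 one_ne_zero) h] at hzero
  · refine Or.inr ⟨κ, hκm, ?_, (b - b').1 / w, ?_, (hat_eq_zero_iff_levelElt hw hbw).1 hzero, ?_⟩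
    · intro hκ
      have h1 := digit_sub_digit_self (Nat.sub_le m κ) hbw
      rw [hbd ⟨κ, hκ⟩, hb'd ⟨κ, hκ⟩, sub_self] at h1
      exact hw h1.symm
    · rw [hfst]
      exact div_ne_zero (neg_ne_zero.2 one_ne_zero) hw
    · intro k hk hlt
      have hkm := le_of_mem_zeroLevels hk
      refine hfull k hk (w * (p : ℤ) ^ (k - κ - 1)) ?_
      rw [hbw, show m - κ = (k - κ - 1) + 1 + (m - k) by omega, pow_add, pow_add]
      push_cast
      ring

theorem isTile_of_isSpectral {A : Finset (ZMod p × ZMod (p ^ (m + 1)))} (hA : A.Nonempty)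
    (h : IsSpectral p (m + 1) A) : IsTile A := by
  have hp : p.Prime := Fact.out
  obtain ⟨B, hcard, hB⟩ := h.exists_hat_eq_zero
  obtain ⟨s, hs⟩ := card_eq_pow_of_spectrum hA hcard hB
  have h1 : p ^ #(zeroLevels A (m + 1)) ≤ p ^ s := by
    rw [← hs]
    exact Nat.le_of_dvd hA.card_pos (pow_card_zeroLevels_dvd A)
  have h2 : p ^ s ≤ p ^ (#(zeroLevels A (m + 1)) + 1) := by
    rw [← hs, ← hcard]
    exact card_le_of_injOn_digitMap (injOn_digitMap_of_spectrum hB)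
  rw [Nat.pow_le_pow_iff_right hp.one_lt] at h1 h2
  rcases h1.eq_or_lt with heq | hlt
  · exact isTile_of_card_eq (by rw [hs, heq])
  · have hs' : s = #(zeroLevels A (m + 1)) + 1 := by omega
    exact isTile_of_hasTwist (by rw [hs, hs']) (hasTwist_of_spectrum (by rw [hcard, hs, hs']) hB)

/-! ### Tiles are spectral sets -/

/-- Each zero level from `j` on, being full, contributes a factor `p` to every single cell. The
factor on the right replaces the subtraction of the zero levels below `j`. -/
lemma pow_dvd_cell_mul_pow {T : Finset (ZMod p × ZMod (p ^ (m + 1)))} {j : ℕ} (hj : j ≤ m + 1)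
    (h : ∀ k ∈ zeroLevels T (m + 1), j ≤ k → ∀ c, hat T (levelElt c k) = 0) (x : ZMod p) (y : ℤ) :
    p ^ #(zeroLevels T (m + 1)) ∣ cell T j x y * p ^ #(zeroLevels T j) := by
  induction hj using Nat.decreasingInduction generalizing x y with
  | self => exact Dvd.intro_left _ rfl
  | of_succ j hj ih =>
    have ih' := ih fun k hk hjk => h k hk (by omega)
    by_cases hz : hat T (levelElt 0 j) = 0
    · rw [← mul_cell_succ (by omega) (h j (mem_zeroLevels.2 ⟨hj, hz⟩) le_rfl)]
      have h1 := ih' x y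
      rwa [card_zeroLevels_succ_of_mem hz, pow_succ, ← mul_assoc, mul_comm, ← mul_assoc] at h1
    · rw [cell_eq_sum_subcell, Finset.sum_mul]
      refine Finset.dvd_sum fun d _ => ?_
      have h1 := subcell_intCast T j y x d.val
      rw [Int.cast_natCast, ZMod.natCast_zmod_val] at h1
      rw [h1, ← zeroLevels_succ_of_ne hz]
      exact ih' _ _

lemma levelElt_ne_zero (c : ZMod p) {k : ℕ} :
    (levelElt c k : ZMod p × ZMod (p ^ (m + 1))) ≠ 0 := by
  have hp : p.Prime := Fact.out
  intro h
  have h1 : (p : ZMod (p ^ (m + 1))) ^ (m - k) = 0 := congrArg Prod.snd h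
  rw [← Nat.cast_pow, ZMod.natCast_eq_zero_iff, Nat.pow_dvd_pow_iff_le_right hp.one_lt] at h1
  omega

/-- Without a twist, zeros missing from `hat A` are forced on `hat T`, and they yield one more
factor `p` in `#T` than its cardinality allows. -/
lemma hasTwist_of_tiling {A T : Finset (ZMod p × ZMod (p ^ (m + 1)))}
    (hT : #T = p ^ #(zeroLevels T (m + 1)))
    (hdisj : ∀ k ∈ zeroLevels A (m + 1), k ∉ zeroLevels T (m + 1))
    (h : ∀ g, g ≠ 0 → hat A g = 0 ∨ hat T g = 0) : HasTwist A := by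
  have hp : p.Prime := Fact.out
  have hnot : ¬ p ^ (#(zeroLevels T (m + 1)) + 1) ∣ #T := by
    rw [hT, Nat.pow_dvd_pow_iff_le_right hp.one_lt]
    omega
  by_contra hcon
  rw [HasTwist, not_or] at hcon
  obtain ⟨hcon1, hcon2⟩ := hcon
  have hTfull : ∀ κ ∈ zeroLevels T (m + 1),
      (∀ k ∈ zeroLevels A (m + 1), κ < k → ∀ c, hat A (levelElt c k) = 0) →
      ∀ c, hat T (levelElt c κ) = 0 := by
    intro κ hκ hfull c
    by_cases hc : c = 0
    · rw [hc]
      exact (mem_zeroLevels.1 hκ).2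
    · refine (h _ (levelElt_ne_zero c)).resolve_left fun hA => ?_
      exact hcon2 ⟨κ, (mem_zeroLevels.1 hκ).1, fun hκA => hdisj κ hκA hκ, c, hc, hA, hfull⟩
  by_cases hall : ∀ k ∈ zeroLevels A (m + 1), ∀ c, hat A (levelElt c k) = 0
  · have h10 : hat T (1, 0) = 0 := by
      refine (h (1, 0) (by simp [Prod.ext_iff])).resolve_left fun hA => hcon1 ⟨hA, hall⟩
    have h1 := pow_dvd_cell_mul_pow (T := T) (Nat.zero_le (m + 1))
      (fun k hk _ => hTfull k hk fun k' hk' _ => hall k' hk') 0 0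
    refine hnot ?_
    rw [← mul_cell_zero h10 0 0, pow_succ']
    exact Nat.mul_dvd_mul_left p (by simpa [zeroLevels] using h1)
  · classical
    push Not at hall
    obtain ⟨k, hk, hk'⟩ := hall
    -- Above the largest zero level `k₁` of `A` that is not full, all zero levels of `T` are full.
    -- At `k₁` itself `hat T` vanishes at some slope, although `k₁` is not a zero level of `T`.
    obtain ⟨k₁, hk₁, hmax⟩ := Finset.exists_max_image
      {k ∈ zeroLevels A (m + 1) | ∃ c, hat A (levelElt c k) ≠ 0} id
      ⟨k, Finset.mem_filter.2 ⟨hk, hk'⟩⟩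
    rw [Finset.mem_filter] at hk₁
    obtain ⟨hk₁A, c, hc⟩ := hk₁
    have hcT := (h _ (levelElt_ne_zero c)).resolve_left hc
    have hk₁m := le_of_mem_zeroLevels hk₁A
    have hk₁T : hat T (levelElt 0 k₁) ≠ 0 := fun h0 =>
      hdisj k₁ hk₁A (mem_zeroLevels.2 ⟨by omega, h0⟩)
    have h1 := pow_dvd_cell_mul_pow (T := T) (j := k₁ + 1) (by omega) fun κ hκ hle =>
      hTfull κ hκ fun k hk hlt => by
        by_contra hne
        push Not at hne
        have := hmax k (Finset.mem_filter.2 ⟨hk, hne⟩)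
        simp only [id] at this
        omega
    rw [zeroLevels_succ_of_ne hk₁T] at h1
    have hle : #(zeroLevels T k₁) ≤ #(zeroLevels T (m + 1)) := by
      refine Finset.card_le_card fun k hk => ?_
      rw [mem_zeroLevels] at hk ⊢
      exact ⟨by omega, hk.2⟩
    have h2 : ∀ x y, p ^ (#(zeroLevels T (m + 1)) - #(zeroLevels T k₁)) ∣
        cell T (k₁ + 1) x y := by
      intro x y
      refine Nat.dvd_of_mul_dvd_mul_right (pow_pos hp.pos #(zeroLevels T k₁)) ?_
      rw [← pow_add, Nat.sub_add_cancel hle]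
      exact h1 x y
    refine hnot ?_
    -- The `+ 1` is the surplus factor from slope `c` at level `k₁`; the zero levels of `T` below
    -- `k₁` supply the remaining powers.
    have h3 := mul_pow_card_zeroLevels_dvd (A := T) (j := k₁) (by omega)
      (q := p ^ (#(zeroLevels T (m + 1)) - #(zeroLevels T k₁) + 1)) fun y => by
        rw [← mul_sum_subcell hk₁m hcT y 0, pow_succ']
        exact Nat.mul_dvd_mul_left p (Finset.dvd_sum fun x _ => dvd_subcell h2 _ _ _)
    rw [← pow_add] at h3
    convert h3 using 2
    omega

theorem isSpectral_of_isTile {A : Finset (ZMod p × ZMod (p ^ (m + 1)))} (hA : A.Nonempty)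
    (h : IsTile A) : IsSpectral p (m + 1) A := by
  have hp : p.Prime := Fact.out
  obtain ⟨T, hcard, hzero⟩ := h.exists_hat_eq_zero
  obtain ⟨s, -, hs⟩ := (Nat.dvd_prime_pow hp).1 (Dvd.intro _ hcard)
  obtain ⟨t, -, ht⟩ := (Nat.dvd_prime_pow hp).1 (Dvd.intro_left _ hcard)
  have hst : s + t = m + 2 := by
    rw [hs, ht, ← pow_add] at hcard
    exact Nat.pow_right_injective hp.two_le hcard
  have hAs : #(zeroLevels A (m + 1)) ≤ s := by
    have := pow_card_zeroLevels_dvd A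
    rwa [hs, Nat.pow_dvd_pow_iff_le_right hp.one_lt] at this
  have hTt : #(zeroLevels T (m + 1)) ≤ t := by
    have := pow_card_zeroLevels_dvd T
    rwa [ht, Nat.pow_dvd_pow_iff_le_right hp.one_lt] at this
  have hsub : Finset.range (m + 1) \ zeroLevels A (m + 1) ⊆ zeroLevels T (m + 1) := by
    intro k hk
    rw [Finset.mem_sdiff, Finset.mem_range, mem_zeroLevels] at hk
    refine mem_zeroLevels.2 ⟨hk.1, ?_⟩
    exact (hzero _ (levelElt_ne_zero 0)).resolve_left fun h0 => hk.2 ⟨hk.1, h0⟩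
  have hcompl := card_zeroLevels_compl A
  have hle := Finset.card_le_card hsub
  rcases hAs.eq_or_lt with heq | hlt
  · exact isSpectral_of_card_eq hA (by rw [hs, heq])
  · have hs' : s = #(zeroLevels A (m + 1)) + 1 := by omega
    have ht' : t = #(zeroLevels T (m + 1)) := by omega
    refine isSpectral_of_hasTwist hA (by rw [hs, hs'])
      (hasTwist_of_tiling (by rw [ht, ht']) (fun k hk => ?_) hzero)
    rw [← Finset.eq_of_subset_of_card_le hsub (by omega), Finset.mem_sdiff]
    exact fun h => h.2 hk

end Main

theorem theorem1p1 (p n : ℕ) [Fact p.Prime] (hn : 0 < n)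
    (A : Finset (ZMod p × ZMod (p ^ n))) (hA : A.Nonempty) :
    IsSpectral p n A ↔ IsTile A := by
  obtain ⟨m, rfl⟩ : ∃ m, n = m + 1 := ⟨n - 1, by omega⟩
  exact ⟨isTile_of_isSpectral hA, isSpectral_of_isTile hA⟩
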